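/- Let $A_n$ denote the alternating group on $n$ letters. For every positive integer $n \le 1{,}000{,}000{,}000$ there exist primes $p$ and $r$ such that, for every proper subgroup $H < A_n$, the index $[A_n : H]$ is divisible by at least one of $p$ or $r$. -/

import Mathlib

/-- `n` satisfies the condition with the numbers `p` and `r`: the index in the alternating group
`A_n` of every proper subgroup is divisible by at least one of `p` or `r`. -/
def ProperIndicesDivisible (n p r : ℕ) : Prop :=
  ∀ H : Subgroup (alternatingGroup (Fin n)), H < ⊤ → p ∣ H.index ∨ r ∣ H.index

/-- There exist primes `p` and `r` such that the index of every proper subgroup of `A_n` is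
divisible by at least one of `p` or `r`. -/
def UniversallyGenerated (n : ℕ) : Prop :=
  ∃ p r : ℕ, p.Prime ∧ r.Prime ∧ ProperIndicesDivisible n p r

/-! Let `q` be a power of a prime `p` dividing `n`, let `ℓ` be a prime, and write `n = c * ℓ + s`
with `s < q`. Suppose that the index of `H ≤ A_n` is prime to `p` and to `ℓ`. An `H`-invariant set
of size `k` forces `n.choose k` to divide the index. So `p ∤ n.choose k`, which gives `q ∣ k`, and
`ℓ ∤ n.choose k`, which by Lucas gives `k % ℓ ≤ s`. For `c = 1` these leave only `k = n`, so `H` is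
transitive; for larger `c` the finitely many other candidates are excluded by testing `p ∣ n.choose
k`.

By Sylow theory `H` contains an `ℓ`-cycle. A nontrivial block contains the support of a conjugate of
that cycle, so there are at most `c` blocks, and the same divisibility, now applied to the orbit of
a block, shows that `H` is primitive. Jordan's theorem (a primitive group with a cycle of prime
length fixing at least three points contains `A_n`) then gives `H = A_n`. The criterion is
`universallyGenerated_of_witness`. Its main case `universallyGenerated_of_sub` asks only for a prime
`n - δ` with `3 ≤ δ < q`, where `q` is a prime power dividing `n`.

It remains to find a witness for each `n ≤ 10 ^ 9`. If some prime power `q ≥ 79` divides `n`, a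
sieve carried out on the bits of large numbers finds a prime at distance less than `q` for almost
all `n`; the few survivors are treated individually. If all prime powers dividing `n` are below 79,
then `n` divides a fixed number, and all such `n` are enumerated. Numbers below 8192 are tested one
by one. -/

section PermutationGroups

open Equiv Equiv.Perm MulAction
open scoped Pointwise

/-! ### Jordan's theorem on primitive groups containing a cycle of prime length -/

section Jordan

variable {α : Type*} [Fintype α] [DecidableEq α] {G : Subgroup (Perm α)}

/-- A group generated by a cycle `g` of prime length is a Sylow subgroup of any group of
permutations supported by the support of `g`. -/
theorem card_dvd_factorial_of_support_subset {K : Subgroup (Perm α)} {s : Finset α}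
    (hK : ∀ k ∈ K, ∀ x ∉ s, k x = x) : Nat.card K ∣ s.card.factorial := by
  have hle : K ≤ (ofSubtype (p := fun x => x ∈ s)).range := by
    intro k hk
    rw [mem_range_ofSubtype_iff]
    intro x hx
    by_contra hxs
    exact (mem_support.mp hx) (hK k hk x hxs)
  have := Subgroup.card_dvd_of_le hle
  rwa [Nat.card_congr (MonoidHom.ofInjective (ofSubtype_injective (p := fun x => x ∈ s))).symm.toEquiv,
    Nat.card_perm, Nat.card_eq_fintype_card (α := s), Fintype.card_coe] at this

omit [DecidableEq α] in
theorem exists_sylow_eq_zpowers {K : Subgroup (Perm α)} {p : ℕ} [hp : Fact p.Prime]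
    (hcard : ¬ p ^ 2 ∣ Nat.card K) (g : K) (hg : orderOf g = p) :
    ∃ Q : Sylow p K, (Q : Subgroup K) = Subgroup.zpowers g := by
  have hP : IsPGroup p (Subgroup.zpowers g) := by
    apply IsPGroup.of_card (n := 1)
    rw [Nat.card_zpowers, hg, pow_one]
  obtain ⟨Q, hQ⟩ := hP.exists_le_sylow
  refine ⟨Q, ?_⟩
  symm
  apply Subgroup.eq_of_le_of_card_ge hQ
  rw [Nat.card_zpowers, hg]
  obtain ⟨k, hk⟩ := (IsPGroup.iff_card).mp Q.isPGroup'
  have hdvd : Nat.card Q ∣ Nat.card K := Subgroup.card_subgroup_dvd_card _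
  change Nat.card Q = _ at hk
  change Nat.card Q ≤ p
  rw [hk] at hdvd ⊢
  have hk1 : k ≤ 1 := by
    by_contra h
    exact hcard ((pow_dvd_pow p (by omega)).trans hdvd)
  calc p ^ k ≤ p ^ 1 := Nat.pow_le_pow_right hp.out.pos hk1
    _ = p := pow_one p

/-- Two elements of prime order `p` of a group whose order is not divisible by `p ^ 2` generate
conjugate subgroups. -/
theorem exists_conj_eq_zpow {K : Subgroup (Perm α)} {p : ℕ} [hp : Fact p.Prime]
    (hcard : ¬ p ^ 2 ∣ Nat.card K) {g g' : Perm α} (hgK : g ∈ K) (hgK' : g' ∈ K)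
    (hg : orderOf g = p) (hg' : orderOf g' = p) :
    ∃ k ∈ K, ∃ m : ℤ, k * g' * k⁻¹ = g ^ m := by
  obtain ⟨Q, hQ⟩ := exists_sylow_eq_zpowers hcard ⟨g, hgK⟩ (by rwa [Subgroup.orderOf_mk])
  obtain ⟨Q', hQ'⟩ := exists_sylow_eq_zpowers hcard ⟨g', hgK'⟩ (by rwa [Subgroup.orderOf_mk])
  obtain ⟨k, hk⟩ := MulAction.exists_smul_eq K Q' Q
  have hmem : k * ⟨g', hgK'⟩ * k⁻¹ ∈ Subgroup.zpowers (⟨g, hgK⟩ : K) := by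
    rw [← hQ, ← hk, Sylow.coe_subgroup_smul, ← MulAut.conj_apply, ← MulAut.smul_def]
    apply Subgroup.smul_mem_pointwise_smul
    rw [hQ']
    exact Subgroup.mem_zpowers _
  obtain ⟨m, hm⟩ := Subgroup.mem_zpowers_iff.mp hmem
  refine ⟨k, k.2, m, ?_⟩
  have := congrArg (Subtype.val) hm
  simpa using this.symm

/-- The pointwise stabilizer of the fixed points of `g` contains `g`, so it is transitive on the
support, and even primitive because the support has prime size. Jordan's criterion lifts this to
multiple primitivity of `G`, one degree more than is needed here. -/
theorem isMultiplyPretransitive_of_isCycle_mem (hG : IsPreprimitive G α) {p : ℕ} (hp : p.Prime)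
    {g : Perm α} (hgc : g.IsCycle) (hgp : g.support.card = p) (hg : g ∈ G)
    (hlt : p < Nat.card α) :
    IsMultiplyPretransitive G α (g.supportᶜ.card) := by
  have hcompl : g.supportᶜ.card = Nat.card α - p := by
    rw [Finset.card_compl, hgp, Nat.card_eq_fintype_card]
  obtain ⟨n, hn⟩ : ∃ n, Nat.card α - p = n + 1 := ⟨Nat.card α - p - 1, by omega⟩
  have htr := isPretransitive_of_isCycle_mem hgc hg
  have h2 := hp.two_le
  classical
  have hprim : IsPreprimitive (fixingSubgroup G (g.support : Set α)ᶜ)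
      (SubMulAction.ofFixingSubgroup G (g.support : Set α)ᶜ) := by
    apply IsPreprimitive.of_prime_card
    convert! hp
    rw [Nat.card_eq_fintype_card, Fintype.card_subtype, ← hgp]
    apply congr_arg
    ext x
    simp [SubMulAction.mem_ofFixingSubgroup_iff]
  have hmul : IsMultiplyPreprimitive G α (n + 2) := by
    apply hG.isMultiplyPreprimitive (s := (g.supportᶜ : Set α)) _ _ hprim
    · rw [← Finset.coe_compl, Set.ncard_coe_finset, hcompl, hn]
    · omega
  have := hmul.isMultiplyPretransitive
  rw [hcompl, hn]
  exact isMultiplyPretransitive_of_le' (n := n + 2) (by omega) (by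
    rw [ENat.card_eq_coe_natCard]; exact_mod_cast (by omega))

/-- A Frattini argument: multiple transitivity gives some `h ∈ G` that agrees with `σ` on the fixed
points of `g`. Both `g` and its conjugate by `h` lie in the pointwise stabilizer `K` of these
points, where they generate Sylow subgroups, so `h` can be corrected by an element of `K`. -/
theorem exists_lift_normalizing (hG : IsPreprimitive G α) {p : ℕ} (hp : p.Prime)
    {g : Perm α} (hgc : g.IsCycle) (hgp : g.support.card = p) (hg : g ∈ G)
    (hlt : p < Nat.card α) (σ : Perm α) (hσ : ∀ x, g x ≠ x → σ x = x) :
    ∃ h ∈ G, (∀ x, g x = x → h x = σ x) ∧ ∃ m : ℤ, h * g * h⁻¹ = g ^ m := by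
  have := Fact.mk hp
  have htrans := isMultiplyPretransitive_of_isCycle_mem hG hp hgc hgp hg hlt
  have hσ' : ∀ x, g x = x → g (σ x) = σ x := by
    intro x hx
    by_contra h
    have := hσ _ h
    rw [σ.injective this] at h
    exact h hx
  let e : Fin (g.supportᶜ.card) ↪ α :=
    (g.supportᶜ.equivFin.symm.toEmbedding).trans (Function.Embedding.subtype _)
  have he : ∀ x, g x = x → ∃ i, e i = x := by
    intro x hx
    have hx' : x ∈ g.supportᶜ := by simp [hx]
    exact ⟨g.supportᶜ.equivFin ⟨x, hx'⟩, by simp [e]⟩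
  obtain ⟨⟨h, hh⟩, hhe⟩ := MulAction.exists_smul_eq G e (e.trans σ.toEmbedding)
  have hhx : ∀ x, g x = x → h x = σ x := by
    intro x hx
    obtain ⟨i, rfl⟩ := he x hx
    exact congrArg (fun f : _ ↪ α => f i) hhe
  let K : Subgroup (Perm α) := G ⊓ (fixingSubgroup (Perm α) {x | g x = x})
  have hKfix : ∀ k ∈ K, ∀ x, g x = x → k x = x := by
    intro k hk x hx
    exact (mem_fixingSubgroup_iff _).mp hk.2 x hx
  -- The order of `K` divides `p! = p * (p - 1)!`, and `p` does not divide `(p - 1)!`.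
  have hcard : ¬ p ^ 2 ∣ Nat.card K := by
    intro hdvd
    have h1 := hdvd.trans (card_dvd_factorial_of_support_subset (K := K) (s := g.support) (by
      intro k hk x hx
      exact hKfix k hk x (by simpa using hx)))
    rw [hgp, ← Nat.mul_factorial_pred hp.ne_zero, pow_two] at h1
    have h2 := Nat.dvd_of_mul_dvd_mul_left hp.pos h1
    have := (hp.dvd_factorial).mp h2
    have := hp.pos
    omega
  have hord : orderOf g = p := by rw [hgc.orderOf, hgp]
  have hgK : g ∈ K := ⟨hg, (mem_fixingSubgroup_iff _).mpr (fun x hx => hx)⟩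
  -- On the finite set of fixed points `σ` is injective, hence surjective, so `h⁻¹` preserves this
  -- set too.
  have hsymm : ∀ x, g x = x → g (h⁻¹ x) = h⁻¹ x := by
    have hbij : Function.Injective (fun x : {x // g x = x} => (⟨σ x, hσ' x x.2⟩ : {x // g x = x})) := by
      intro x y hxy
      exact Subtype.ext (σ.injective (congrArg Subtype.val hxy))
    intro x hx
    obtain ⟨y, hy⟩ := (Finite.injective_iff_surjective.mp hbij) ⟨x, hx⟩
    have hy' : σ y = x := congrArg Subtype.val hy
    rw [← hhx y y.2] at hy'
    rw [← hy', show h⁻¹ (h y) = y from h.symm_apply_apply y]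
    exact y.2
  have hgK' : h * g * h⁻¹ ∈ K := by
    refine ⟨G.mul_mem (G.mul_mem hh hg) (G.inv_mem hh), (mem_fixingSubgroup_iff _).mpr ?_⟩
    intro x hx
    change h (g (h⁻¹ x)) = x
    rw [hsymm x hx]
    exact h.apply_symm_apply x
  have hord' : orderOf (h * g * h⁻¹) = p := by
    rw [← MulAut.conj_apply, MulEquiv.orderOf_eq, hord]
  obtain ⟨k, hk, m, hkm⟩ := exists_conj_eq_zpow hcard hgK hgK' hord hord'
  refine ⟨k * h, G.mul_mem hk.1 hh, ?_, m, ?_⟩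
  · intro x hx
    rw [Perm.mul_apply, hhx x hx, hKfix k hk _ (hσ' x hx)]
  · rw [← hkm]; group

theorem Equiv.Perm.IsThreeCycle.pow_prime {τ : Perm α} (hτ : τ.IsThreeCycle) {p : ℕ}
    (hp : p.Prime) (h3 : p ≠ 3) : (τ ^ p).IsThreeCycle := by
  have hmod : p % 3 = 1 ∨ p % 3 = 2 := by
    have : p % 3 ≠ 0 := fun h => h3 ((Nat.prime_dvd_prime_iff_eq Nat.prime_three hp).mp
      (Nat.dvd_of_mod_eq_zero h)).symm
    omega
  rw [← pow_mod_orderOf, hτ.orderOf]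
  rcases hmod with h | h
  · rw [h, pow_one]; exact hτ
  · rw [h, pow_two]; exact hτ.isThreeCycle_sq

/-- A primitive permutation group that contains a cycle of prime length fixing at least three
points contains the alternating group (Jordan). -/
theorem alternatingGroup_le_of_isCycle_mem (hG : IsPreprimitive G α) {p : ℕ} (hp : p.Prime)
    (hlt : p + 3 ≤ Nat.card α) {g : Perm α} (hgc : g.IsCycle) (hgp : g.support.card = p)
    (hg : g ∈ G) : alternatingGroup α ≤ G := by
  by_cases h3 : p = 3
  · exact alternatingGroup_le_of_isPreprimitive_of_isThreeCycle_mem hG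
      (card_support_eq_three_iff.mp (hgp.trans h3)) hg
  have hcompl : 2 < g.supportᶜ.card := by
    rw [Finset.card_compl, hgp, ← Nat.card_eq_fintype_card]; omega
  obtain ⟨a, b, c, ha, hb, hc, hab, hac, hbc⟩ := Finset.two_lt_card_iff.mp hcompl
  simp only [Finset.mem_compl, notMem_support] at ha hb hc
  have hswap : ∀ {x y : α}, g x = x → g y = y → ∀ z, g z ≠ z → swap x y z = z := by
    intro x y hx hy z hz
    apply swap_apply_of_ne_of_ne <;> rintro rfl <;> exact hz (by assumption)
  obtain ⟨h₁, hh₁, hx₁, m₁, hm₁⟩ := exists_lift_normalizing hG hp hgc hgp hg (by omega)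
    (swap a b) (hswap ha hb)
  obtain ⟨h₂, hh₂, hx₂, m₂, hm₂⟩ := exists_lift_normalizing hG hp hgc hgp hg (by omega)
    (swap a c) (hswap ha hc)
  -- `τ` is the commutator of two transpositions, a 3-cycle; `w` is the commutator of their lifts.
  set τ : Perm α := swap a b * swap a c * (swap a c * swap a b)⁻¹ with hτ
  set w : Perm α := h₁ * h₂ * (h₂ * h₁)⁻¹ with hw
  have hwG : w ∈ G := G.mul_mem (G.mul_mem hh₁ hh₂) (G.inv_mem (G.mul_mem hh₂ hh₁))
  have hτ3 : τ.IsThreeCycle := by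
    have h1 : (swap a b * swap a c).IsThreeCycle := isThreeCycle_swap_mul_swap_same hab hac hbc
    have h2 : τ = (swap a b * swap a c) * (swap a b * swap a c) := by
      rw [hτ, mul_inv_rev, swap_inv, swap_inv]
    rw [h2]; exact h1.isThreeCycle_sq
  have hfix : ∀ x, g x = x → ∀ {u v : α}, g u = u → g v = v → g (swap u v x) = swap u v x := by
    intro x hx u v hu hv
    rw [swap_apply_def]; split_ifs <;> assumption
  have hwτ : ∀ x, g x = x → w x = τ x ∧ g (τ x) = τ x := by
    intro x hx
    have h1 := hfix x hx ha hc
    have h2 := hfix _ h1 ha hb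
    have h0 : (h₂ * h₁)⁻¹ x = (swap a c * swap a b)⁻¹ x := by
      rw [Perm.inv_eq_iff_eq, mul_inv_rev, swap_inv, swap_inv, Perm.mul_apply, Perm.mul_apply,
        hx₁ _ h2, swap_apply_self, hx₂ _ h1, swap_apply_self]
    have h3 : τ x = swap a b (swap a c (swap a b (swap a c x))) := by
      rw [hτ, mul_inv_rev, swap_inv, swap_inv]; rfl
    have h4 := hfix _ h2 ha hc
    refine ⟨?_, ?_⟩
    · rw [hw, hτ, Perm.mul_apply, h0, mul_inv_rev, swap_inv, swap_inv]
      simp only [Perm.mul_apply]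
      rw [hx₂ _ h2, hx₁ _ h4]
    · rw [h3]; exact hfix _ h4 ha hb
  have hpow : ∀ k : ℕ, ∀ x, g x = x → (w ^ k) x = (τ ^ k) x ∧ g ((τ ^ k) x) = (τ ^ k) x := by
    intro k
    induction k with
    | zero => intro x hx; simp [hx]
    | succ k ih =>
      intro x hx
      rw [pow_succ', pow_succ', Perm.mul_apply, Perm.mul_apply, (ih x hx).1]
      exact hwτ _ (ih x hx).2
  -- The automorphism group of the cyclic group generated by `g` is abelian, so a commutator of
  -- elements normalizing that group centralizes it.
  have hcomm : Commute w g := by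
    have e1 : (h₁ * h₂) * g * (h₁ * h₂)⁻¹ = g ^ (m₁ * m₂) := by
      rw [zpow_mul, ← hm₁, conj_zpow, ← hm₂]; group
    have e2 : (h₂ * h₁) * g * (h₂ * h₁)⁻¹ = g ^ (m₁ * m₂) := by
      rw [mul_comm m₁ m₂, zpow_mul, ← hm₂, conj_zpow, ← hm₁]; group
    have hgen : g ∈ Subgroup.zpowers (g ^ (m₁ * m₂)) := by
      have hle : Subgroup.zpowers (g ^ (m₁ * m₂)) ≤ Subgroup.zpowers g := by
        rw [Subgroup.zpowers_le]
        exact Subgroup.zpow_mem _ (Subgroup.mem_zpowers g) _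
      rw [Subgroup.eq_of_le_of_card_ge hle]
      · exact Subgroup.mem_zpowers g
      · rw [Nat.card_zpowers, Nat.card_zpowers, ← e2, ← MulAut.conj_apply, MulEquiv.orderOf_eq]
    obtain ⟨j, hj⟩ := Subgroup.mem_zpowers_iff.mp hgen
    rw [← hj]
    refine Commute.zpow_right ?_ j
    change w * g ^ (m₁ * m₂) = g ^ (m₁ * m₂) * w
    nth_rewrite 1 [← e2]
    rw [← e1, hw]
    group
  -- A permutation commuting with the cycle `g` acts on its support as a power of `g`. So `w ^ p` is
  -- trivial there and equals `τ ^ p` everywhere, which is a 3-cycle since `p ≠ 3`.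
  obtain ⟨y, hy, hcyc⟩ := id hgc
  have hsupp : ∀ z, g z ≠ z → g (w z) ≠ w z := by
    intro z hz h
    have h1 : w (g z) = g (w z) := congrArg (fun f : Perm α => f z) hcomm.eq
    rw [h] at h1
    exact hz (w.injective h1)
  obtain ⟨j, hj⟩ := hgc.exists_zpow_eq hy (hsupp y hy)
  have hwz : ∀ z, g z ≠ z → w z = (g ^ j) z := by
    intro z hz
    obtain ⟨i, rfl⟩ := hgc.exists_zpow_eq hy hz
    have h1 : w ((g ^ i) y) = (g ^ i) (w y) :=
      congrArg (fun f : Perm α => f y) (hcomm.zpow_right i).eq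
    rw [h1, ← hj, ← Perm.mul_apply, ← Perm.mul_apply, ← zpow_add, ← zpow_add, add_comm]
  have hwpow : ∀ k : ℕ, ∀ z, g z ≠ z → (w ^ k) z = ((g ^ j) ^ k) z := by
    intro k
    induction k with
    | zero => intro z _; rfl
    | succ k ih =>
      intro z hz
      rw [pow_succ, pow_succ]
      change (w ^ k) (w z) = ((g ^ j) ^ k) ((g ^ j) z)
      rw [ih _ (hsupp z hz), hwz z hz]
  have hgpow : (g ^ j) ^ p = 1 := by
    rw [← zpow_natCast, ← zpow_mul, mul_comm, zpow_mul, zpow_natCast, ← hgp, ← hgc.orderOf,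
      pow_orderOf_eq_one, one_zpow]
  have hτfix : ∀ z, g z ≠ z → τ z = z := by
    intro z hz
    have h1 := hswap ha hb z hz
    have h2 := hswap ha hc z hz
    rw [hτ, mul_inv_rev, swap_inv, swap_inv]
    simp only [Perm.mul_apply, h1, h2]
  have hwp : w ^ p = τ ^ p := by
    ext z
    by_cases hz : g z = z
    · exact (hpow p z hz).1
    · rw [hwpow p z hz, hgpow]
      have : ∀ k : ℕ, (τ ^ k) z = z := by
        intro k
        induction k with
        | zero => rfl
        | succ k ih => rw [pow_succ, Perm.mul_apply, hτfix z hz, ih]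
      rw [this]; rfl
  refine alternatingGroup_le_of_isPreprimitive_of_isThreeCycle_mem hG (g := w ^ p) ?_
    (G.pow_mem hwG p)
  rw [hwp]
  exact hτ3.pow_prime hp h3

end Jordan

/-! ### Divisibility relations between the index of a subgroup and its orbits -/

section OrbitSizes

/-- By the orbit-stabilizer theorem for `A` and for `H`, the quotient is the index of the stabilizer
in `H` inside the stabilizer in `A`. -/
theorem card_dvd_index_mul_card_orbit {A X : Type*} [Group A] [Finite A] [MulAction A X]
    [IsPretransitive A X] (H : Subgroup A) (x : X) :
    Nat.card X ∣ H.index * Nat.card (orbit H x) := by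
  have hA : Nat.card X * Nat.card (stabilizer A x) = Nat.card A := by
    rw [← index_stabilizer_of_transitive A x, Subgroup.index_mul_card]
  have hH : Nat.card (orbit H x) * Nat.card (stabilizer H x) = Nat.card H := by
    rw [Nat.card_congr (orbitEquivQuotientStabilizer H x), ← Subgroup.index,
      Subgroup.index_mul_card]
  have hdvd : Nat.card (stabilizer H x) ∣ Nat.card (stabilizer A x) := by
    have hinj : Function.Injective (fun h : stabilizer H x =>
        (⟨(h : H), h.2⟩ : stabilizer A x)) := by
      intro a b hab
      exact Subtype.ext (Subtype.ext (congrArg (fun z : stabilizer A x => (z : A)) hab))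
    exact Subgroup.card_dvd_of_injective
      (⟨⟨fun h : stabilizer H x => (⟨(h : H), h.2⟩ : stabilizer A x), rfl⟩, fun _ _ => rfl⟩ :
        stabilizer H x →* stabilizer A x) hinj
  obtain ⟨m, hm⟩ := hdvd
  refine ⟨m, ?_⟩
  have hpos : 0 < Nat.card (stabilizer H x) := Nat.card_pos
  apply Nat.eq_of_mul_eq_mul_right hpos
  rw [mul_assoc, hH, Subgroup.index_mul_card, ← hA, hm]
  ring

variable {α : Type*} [Fintype α] [DecidableEq α]

/-- The alternating group on at least three letters is transitive on subsets of a given size. An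
invariant set `B` has an orbit of size one, and a block has an orbit as large as the number of
blocks. -/
theorem choose_dvd_index_mul_ncard_orbit (hα : 3 ≤ Nat.card α)
    (H : Subgroup (alternatingGroup α)) (B : Set α) :
    (Nat.card α).choose B.ncard ∣ H.index * (orbit H B).ncard := by
  classical
  have := Set.powersetCard.isPretransitive_alternatingGroup (α := α) (n := B.ncard) hα
  let x : Set.powersetCard α B.ncard := ⟨B.toFinset, by
    rw [Set.powersetCard.mem_iff, Set.ncard_eq_toFinset_card']⟩
  have h1 := card_dvd_index_mul_card_orbit H x
  rw [Set.powersetCard.card] at h1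
  have hinj : Function.Injective (fun y : Set.powersetCard α B.ncard => ((y : Finset α) : Set α)) :=
    Finset.coe_injective.comp Subtype.coe_injective
  have h2 : orbit H B = (fun y : Set.powersetCard α B.ncard => ((y : Finset α) : Set α)) ''
      orbit H x := by
    ext C
    simp only [mem_orbit_iff, Set.mem_image]
    constructor
    · rintro ⟨h, rfl⟩
      refine ⟨h • x, ⟨h, rfl⟩, ?_⟩
      simp [x, Set.powersetCard.coe_smul, Subgroup.smul_def]
    · rintro ⟨_, ⟨h, rfl⟩, rfl⟩
      exact ⟨h, by simp [x, Set.powersetCard.coe_smul, Subgroup.smul_def]⟩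
  rwa [h2, Set.ncard_image_of_injective _ hinj]

/-- The `r`-group generated by `x` acts on the cosets of `H`, whose number is prime to `r`, so it
fixes one of them. -/
theorem exists_conj_mem_of_not_dvd_index {A : Type*} [Group A] [Finite A] {H : Subgroup A} {r : ℕ}
    [hr : Fact r.Prime] (hH : ¬ r ∣ H.index) {x : A} (hx : x ^ r = 1) :
    ∃ a : A, a⁻¹ * x * a ∈ H := by
  have hP : IsPGroup r (Subgroup.zpowers x) := by
    rintro ⟨y, hy⟩
    obtain ⟨j, rfl⟩ := Subgroup.mem_zpowers_iff.mp hy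
    refine ⟨1, Subtype.ext ?_⟩
    simp only [pow_one, SubmonoidClass.mk_pow, OneMemClass.coe_one]
    rw [← zpow_natCast, ← zpow_mul, mul_comm, zpow_mul, zpow_natCast, hx, one_zpow]
  obtain ⟨y, hy⟩ := hP.nonempty_fixed_point_of_prime_not_dvd_card (A ⧸ H) hH
  obtain ⟨a, rfl⟩ := QuotientGroup.mk_surjective y
  refine ⟨a, ?_⟩
  have := hy ⟨x, Subgroup.mem_zpowers x⟩
  have h2 : ((x * a : A) : A ⧸ H) = (a : A ⧸ H) := this
  rw [eq_comm, QuotientGroup.eq] at h2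
  rwa [mul_assoc]

theorem exists_isCycle_mem_of_not_dvd_index {H : Subgroup (alternatingGroup α)} {r : ℕ}
    (hr : r.Prime) (hr3 : 3 ≤ r) (hrα : r ≤ Fintype.card α) (hH : ¬ r ∣ H.index) :
    ∃ g ∈ H, (g : Perm α).IsCycle ∧ (g : Perm α).support.card = r := by
  have := Fact.mk hr
  obtain ⟨g, hg⟩ := (exists_with_cycleType_iff α (m := {r})).mpr
    ⟨by simpa using hrα, by simpa using hr.two_le⟩
  have hgc : g.IsCycle := card_cycleType_eq_one.mp (by rw [hg]; rfl)
  have hgr : g.support.card = r := by rw [← sum_cycleType, hg]; simp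
  have hodd : Odd r := hr.odd_of_ne_two (by omega)
  have hgA : g ∈ alternatingGroup α := by
    rw [mem_alternatingGroup, hgc.sign, hgr, hodd.neg_one_pow, neg_neg]
  obtain ⟨a, ha⟩ := exists_conj_mem_of_not_dvd_index hH (x := ⟨g, hgA⟩) (by
    apply Subtype.ext
    simp only [SubmonoidClass.mk_pow, OneMemClass.coe_one]
    rw [← hgr, ← hgc.orderOf, pow_orderOf_eq_one])
  refine ⟨_, ha, ?_, ?_⟩
  · have := hgc.conj (g := (a : Perm α)⁻¹)
    simpa using this
  · have := card_support_conj (σ := (a : Perm α)⁻¹) (τ := g)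
    rw [← hgr, ← this]
    simp

end OrbitSizes

/-! ### Divisibility of binomial coefficients -/

section Numeric

theorem dvd_choose_of_mod_lt {ℓ n k : ℕ} (hℓ : ℓ.Prime) (h : n % ℓ < k % ℓ) : ℓ ∣ n.choose k := by
  have := Fact.mk hℓ
  have h1 := Choose.choose_modEq_choose_mod_mul_choose_div_nat (n := n) (k := k) (p := ℓ)
  rw [Nat.choose_eq_zero_of_lt h, zero_mul] at h1
  exact (Nat.modEq_zero_iff_dvd).mp h1

/-- From `k * n.choose k = n * (n - 1).choose (k - 1)`, where the power `q` of `p` must divide the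
factor `k`. -/
theorem dvd_of_not_dvd_choose {p q n k a : ℕ} (hp : p.Prime) (hqp : q ∣ p ^ a) (hqn : q ∣ n)
    (hk : 0 < k) (h : ¬ p ∣ n.choose k) : q ∣ k := by
  obtain ⟨k, rfl⟩ : ∃ j, k = j + 1 := ⟨k - 1, by omega⟩
  rcases Nat.eq_zero_or_pos n with rfl | hn
  · simp at h
  obtain ⟨n, rfl⟩ : ∃ j, n = j + 1 := ⟨n - 1, by omega⟩
  have h1 : q ∣ (n + 1).choose (k + 1) * (k + 1) := by
    rw [← Nat.add_one_mul_choose_eq]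
    exact hqn.mul_right _
  refine Nat.Coprime.dvd_of_dvd_mul_left ?_ h1
  exact Nat.Coprime.of_dvd_left hqp (Nat.Coprime.pow_left a ((hp.coprime_iff_not_dvd).mpr h))

end Numeric

/-! ### The criterion for a pair of primes, and the smallest degrees -/

section Criterion

variable {α : Type*} [Fintype α] [DecidableEq α]

/-- Write `k = i * ℓ + t`. Lucas gives `t ≤ s`, and `q ∣ k`. For `i = 0` this contradicts `s < q`;
the other candidates are those treated by `hT`. -/
theorem eq_of_not_dvd_choose {p q ℓ n c s a k : ℕ} (hp : p.Prime) (hℓ : ℓ.Prime) (hqp : q ∣ p ^ a)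
    (hqn : q ∣ n) (hn : n = c * ℓ + s) (hs : s < ℓ) (hsq : s < q)
    (hT : ∀ i t, 1 ≤ i → i ≤ c → t ≤ s → q ∣ i * ℓ + t →
      i * ℓ + t = n ∨ p ∣ n.choose (i * ℓ + t))
    (hk : 0 < k) (hkn : k ≤ n) (hpk : ¬ p ∣ n.choose k) (hℓk : ¬ ℓ ∣ n.choose k) : k = n := by
  have hqk : q ∣ k := dvd_of_not_dvd_choose hp hqp hqn hk hpk
  have hns : n % ℓ = s := by rw [hn, mul_comm, Nat.mul_add_mod, Nat.mod_eq_of_lt hs]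
  have hks : k % ℓ ≤ s := by
    by_contra h
    exact hℓk (dvd_choose_of_mod_lt hℓ (by omega))
  have hdiv : k / ℓ * ℓ + k % ℓ = k := Nat.div_add_mod' k ℓ
  have hic : k / ℓ ≤ c := by
    calc k / ℓ ≤ n / ℓ := Nat.div_le_div_right hkn
      _ = c := by
        rw [hn, mul_comm, Nat.mul_add_div hℓ.pos, Nat.div_eq_of_lt hs, add_zero]
  rcases Nat.eq_zero_or_pos (k / ℓ) with h0 | h0
  · rw [h0, zero_mul, zero_add] at hdiv
    have := Nat.le_of_dvd hk hqk
    omega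
  · rcases hT (k / ℓ) (k % ℓ) h0 hic hks (by rwa [hdiv]) with h | h
    · rwa [hdiv] at h
    · rw [hdiv] at h
      exact absurd h hpk

/-- A translate of the block meets the support of `g`. Having a second point, it is preserved by
`g`: either that point is fixed by `g`, or it is moved from the first by a power of `g`, which
generates the same group as `g` since `ℓ` is prime. Hence it contains the whole support. -/
theorem le_ncard_of_isBlock {H : Subgroup (alternatingGroup α)} [IsPretransitive H α] {ℓ : ℕ}
    (hℓ : ℓ.Prime) {g : alternatingGroup α} (hgH : g ∈ H) (hgc : (g : Perm α).IsCycle)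
    (hgℓ : (g : Perm α).support.card = ℓ) {B : Set α} (hB : IsBlock H B) (hB2 : 1 < B.ncard) :
    ℓ ≤ B.ncard := by
  obtain ⟨y, hy, -⟩ := id hgc
  obtain ⟨b, hb⟩ := Set.nonempty_of_ncard_ne_zero (s := B) (by omega)
  obtain ⟨h, rfl⟩ := exists_smul_eq H b y
  have hC : IsBlock H (h • B) := hB.translate h
  have hCcard : (h • B).ncard = B.ncard := Set.ncard_smul_set h B
  rw [← hCcard] at hB2 ⊢
  have hyC : h • b ∈ h • B := Set.smul_mem_smul_set hb
  generalize h • B = C at *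
  generalize h • b = y at *
  have hmem : ∀ k : H, ∀ z ∈ C, k • z ∈ C → k • C = C := by
    intro k z hz hkz
    exact (isBlock_iff_smul_eq_of_mem.mp hC) hz hkz
  let x : H := ⟨g, hgH⟩
  have hx : ∀ z, x • z = (g : Perm α) z := fun z => rfl
  have hxC : x • C = C := by
    obtain ⟨z, hz, hzy⟩ := Set.exists_ne_of_one_lt_ncard hB2 y
    by_cases hgz : (g : Perm α) z = z
    · exact hmem x z hz (by rwa [hx, hgz])
    · obtain ⟨i, hi⟩ := hgc.exists_zpow_eq hy hgz
      have hstab : x ^ i ∈ stabilizer H C := by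
        apply hmem _ y hyC
        have : (x ^ i) • y = ((g : Perm α) ^ i) y := by
          rw [← Subgroup.coe_zpow]; rfl
        rw [this, hi]; exact hz
      have hord : orderOf x = ℓ := by
        rw [← hgℓ, ← hgc.orderOf, ← Subgroup.orderOf_coe x, ← Subgroup.orderOf_coe (x : alternatingGroup α)]
      have hcop : IsCoprime i (ℓ : ℤ) := by
        rw [isCoprime_comm, (Nat.prime_iff_prime_int.mp hℓ).coprime_iff_not_dvd]
        rintro ⟨j, rfl⟩
        apply hzy
        rw [← hi, zpow_mul, zpow_natCast, ← hgℓ, ← hgc.orderOf, pow_orderOf_eq_one, one_zpow]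
        rfl
      obtain ⟨u, v, huv⟩ := hcop
      have hx1 : x = (x ^ i) ^ u := by
        have h0 : x ^ (v * (ℓ : ℤ)) = 1 := by
          rw [mul_comm, zpow_mul, zpow_natCast, ← hord, pow_orderOf_eq_one, one_zpow]
        calc x = x ^ (u * i + v * (ℓ : ℤ)) := by rw [huv, zpow_one]
          _ = (x ^ i) ^ u := by rw [zpow_add, h0, mul_one, mul_comm, zpow_mul]
      have : x ∈ stabilizer H C := by
        rw [hx1]; exact Subgroup.zpow_mem _ hstab u
      exact this
  have hsub : ((g : Perm α).support : Set α) ⊆ C := by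
    intro z hz
    obtain ⟨i, rfl⟩ := hgc.exists_zpow_eq hy (mem_support.mp hz)
    have hi : x ^ i ∈ stabilizer H C := Subgroup.zpow_mem _ (show x ∈ stabilizer H C from hxC) i
    have : (x ^ i) • y ∈ (x ^ i) • C := Set.smul_mem_smul_set hyC
    rw [show (x ^ i) • C = C from hi] at this
    have h2 : (x ^ i) • y = ((g : Perm α) ^ i) y := by
      rw [← Subgroup.coe_zpow]; rfl
    rwa [← h2]
  calc ℓ = ((g : Perm α).support : Set α).ncard := by rw [Set.ncard_coe_finset, hgℓ]
    _ ≤ C.ncard := Set.ncard_le_ncard hsub (Set.toFinite _)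

theorem eq_top_of_isPreprimitive_of_isCycle_mem {H : Subgroup (alternatingGroup α)}
    (hH : IsPreprimitive H α) {r : ℕ} (hr : r.Prime) (hrα : r = 3 ∨ r + 3 ≤ Nat.card α)
    {g : alternatingGroup α} (hgH : g ∈ H) (hgc : (g : Perm α).IsCycle)
    (hgr : (g : Perm α).support.card = r) : H = ⊤ := by
  set G : Subgroup (Perm α) := H.map (alternatingGroup α).subtype with hG
  have hgG : (g : Perm α) ∈ G := ⟨g, hgH, rfl⟩
  have hprim : IsPreprimitive G α := by
    let φ : H → G := fun h => ⟨h, h, h.2, rfl⟩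
    let f : α →ₑ[φ] α := { toFun := id, map_smul' := fun _ _ => rfl }
    exact IsPreprimitive.of_surjective (f := f) Function.surjective_id
  have hle : alternatingGroup α ≤ G := by
    rcases hrα with h3 | hrα
    · exact alternatingGroup_le_of_isPreprimitive_of_isThreeCycle_mem hprim
        (card_support_eq_three_iff.mp (hgr.trans h3)) hgG
    · exact alternatingGroup_le_of_isCycle_mem hprim hr hrα hgc hgr hgG
  rw [eq_top_iff]
  rintro ⟨x, hx⟩ -
  obtain ⟨y, hy, hyx⟩ := hle hx
  have : y = ⟨x, hx⟩ := Subtype.ext hyx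
  rwa [← this]

/-- `hT` makes `H` transitive and handles systems of blocks whose number is prime to `p`; `hP`
excludes those whose number is divisible by `p`; `hJ` supplies the cycle for Jordan's theorem, where
length 3 needs no three fixed points. -/
theorem eq_top_of_not_dvd_index {H : Subgroup (alternatingGroup α)} {p q ℓ n c s a : ℕ}
    (hα : Nat.card α = n) (hn3 : 3 ≤ n) (hp : p.Prime) (hℓ : ℓ.Prime) (hqp : q ∣ p ^ a)
    (hqn : q ∣ n) (hn : n = c * ℓ + s) (hc : c < ℓ) (hs : s < ℓ) (hsq : s < q) (hℓ3 : 3 ≤ ℓ)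
    (hc1 : 1 ≤ c)
    (hT : ∀ i t, 1 ≤ i → i ≤ c → t ≤ s → q ∣ i * ℓ + t →
      i * ℓ + t = n ∨ p ∣ n.choose (i * ℓ + t))
    (hP : ∀ k, 2 ≤ k → k ≤ c → k ∣ n → p ∣ k → s < n / k % ℓ)
    (hJ : ∃ r, (r = p ∨ r = ℓ) ∧ 3 ≤ r ∧ r ≤ n ∧ (r = 3 ∨ r + 3 ≤ n))
    (hpH : ¬ p ∣ H.index) (hℓH : ¬ ℓ ∣ H.index) : H = ⊤ := by
  have hα' : 3 ≤ Nat.card α := by omega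
  have hnum : ∀ k, 0 < k → k ≤ n → ¬ p ∣ n.choose k → ¬ ℓ ∣ n.choose k → k = n :=
    fun k => eq_of_not_dvd_choose hp hℓ hqp hqn hn hs hsq hT
  have htrans : IsPretransitive H α := by
    have hne : Nonempty α := (Nat.card_pos_iff.mp (by omega)).1
    obtain ⟨x⟩ := hne
    have h1 := choose_dvd_index_mul_ncard_orbit hα' H (orbit H x)
    have h2 : orbit H (orbit H x) = {orbit H x} := by
      ext C
      simp only [mem_orbit_iff, smul_orbit, Set.mem_singleton_iff, exists_const, eq_comm]
    rw [h2, Set.ncard_singleton, mul_one, hα] at h1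
    have h3 : (orbit H x).ncard = n := by
      apply hnum
      · rw [Set.ncard_pos]; exact ⟨x, mem_orbit_self x⟩
      · rw [← hα]; exact Set.ncard_le_card _
      · exact fun h => hpH (h.trans h1)
      · exact fun h => hℓH (h.trans h1)
    rw [isPretransitive_iff_orbit_eq_univ x]
    apply Set.eq_of_subset_of_ncard_le (Set.subset_univ _)
    rw [Set.ncard_univ, hα, h3]
  have hℓn : ℓ ≤ n := by nlinarith
  have hcardα : Fintype.card α = n := by rw [← hα, Nat.card_eq_fintype_card]
  obtain ⟨g, hgH, hgc, hgℓ⟩ := exists_isCycle_mem_of_not_dvd_index hℓ hℓ3 (by omega) hℓH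
  have hprim : IsPreprimitive H α := by
    refine ⟨fun {B} hB => ?_⟩
    by_contra htriv
    have hB2 : 1 < B.ncard := by
      by_contra h
      exact htriv (Or.inl ((Set.ncard_le_one_iff_subsingleton).mp (by omega)))
    have hBne : B.Nonempty := Set.nonempty_of_ncard_ne_zero (by omega)
    have hmul := hB.ncard_block_mul_ncard_orbit_eq hBne
    rw [hα] at hmul
    have hBn : B.ncard ≠ n := by
      intro h
      apply htriv
      right
      apply Set.eq_of_subset_of_ncard_le (Set.subset_univ _)
      rw [Set.ncard_univ, hα, h]
    have hBℓ := le_ncard_of_isBlock hℓ hgH hgc hgℓ hB hB2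
    have hdvd := choose_dvd_index_mul_ncard_orbit hα' H B
    rw [hα] at hdvd
    set k := (orbit H B).ncard with hk
    set d := B.ncard with hd
    have hk0 : k ≠ 0 := by rintro h; rw [h] at hmul; omega
    have hk1 : k ≠ 1 := by rintro h; rw [h] at hmul; omega
    -- There are `k` blocks of size `d ≥ ℓ`, and `n < (c + 1) * ℓ`.
    have hkc : k ≤ c := by
      by_contra h
      have : ℓ * (c + 1) ≤ d * k := Nat.mul_le_mul hBℓ (by omega)
      nlinarith
    have hℓk : ¬ ℓ ∣ k := fun h => by
      have := Nat.le_of_dvd (by omega) h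
      omega
    have hℓC : ¬ ℓ ∣ n.choose d := by
      intro h
      rcases hℓ.dvd_mul.mp (h.trans hdvd) with h | h
      · exact hℓH h
      · exact hℓk h
    -- Otherwise neither prime divides `n.choose d`, and the argument for transitivity gives `d =
    -- n`.
    have hpk : p ∣ k := by
      by_contra h
      apply hBn
      apply hnum d (by omega) (Nat.le_of_dvd (by omega) ⟨k, hmul.symm⟩) _ hℓC
      intro h'
      rcases hp.dvd_mul.mp (h'.trans hdvd) with h' | h'
      · exact hpH h'
      · exact h h'
    have hkn : k ∣ n := ⟨d, by rw [← hmul, mul_comm]⟩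
    have hnk : n / k = d := by rw [← hmul]; exact Nat.mul_div_cancel d (by omega)
    have hsd := hP k (by omega) hkc hkn hpk
    rw [hnk] at hsd
    apply hℓC
    apply dvd_choose_of_mod_lt hℓ
    rwa [hn, mul_comm, Nat.mul_add_mod, Nat.mod_eq_of_lt hs]
  obtain ⟨r, hr, hr3, hrn, hr'⟩ := hJ
  have hrp : r.Prime := by rcases hr with rfl | rfl <;> assumption
  have hrH : ¬ r ∣ H.index := by rcases hr with rfl | rfl <;> assumption
  obtain ⟨x, hxH, hxc, hxr⟩ := exists_isCycle_mem_of_not_dvd_index hrp hr3 (by omega) hrH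
  exact eq_top_of_isPreprimitive_of_isCycle_mem hprim hrp (by rwa [hα]) hxH hxc hxr

theorem universallyGenerated_of_witness {p q ℓ n c s a : ℕ}
    (hn3 : 3 ≤ n) (hp : p.Prime) (hℓ : ℓ.Prime) (hqp : q ∣ p ^ a)
    (hqn : q ∣ n) (hn : n = c * ℓ + s) (hc : c < ℓ) (hs : s < ℓ) (hsq : s < q) (hℓ3 : 3 ≤ ℓ)
    (hc1 : 1 ≤ c)
    (hT : ∀ i t, 1 ≤ i → i ≤ c → t ≤ s → q ∣ i * ℓ + t →
      i * ℓ + t = n ∨ p ∣ n.choose (i * ℓ + t))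
    (hP : ∀ k, 2 ≤ k → k ≤ c → k ∣ n → p ∣ k → s < n / k % ℓ)
    (hJ : ∃ r, (r = p ∨ r = ℓ) ∧ 3 ≤ r ∧ r ≤ n ∧ (r = 3 ∨ r + 3 ≤ n)) :
    UniversallyGenerated n := by
  refine ⟨p, ℓ, hp, hℓ, fun H hH => ?_⟩
  by_contra! h
  exact hH.ne (eq_top_of_not_dvd_index (by simp) hn3 hp hℓ hqp hqn hn hc hs hsq hℓ3 hc1 hT hP hJ
    h.1 h.2)

/-- The case `c = 1`: the only candidates are `ℓ + t` with `t ≤ s < q`, and `q` divides both this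
and `ℓ + s`, so `t = s`. -/
theorem universallyGenerated_of_prime {p q ℓ n a : ℕ} (hp : p.Prime) (hℓ : ℓ.Prime)
    (hqp : q ∣ p ^ a) (hqn : q ∣ n) (h3 : ℓ + 3 ≤ n) (hnℓ : n < ℓ + q) (h2 : n < 2 * ℓ) :
    UniversallyGenerated n := by
  obtain ⟨s, rfl⟩ := Nat.exists_eq_add_of_le (show ℓ ≤ n by omega)
  refine universallyGenerated_of_witness (c := 1) (s := s) (by omega) hp hℓ hqp hqn (by ring)
    hℓ.one_lt (by omega) (by omega) (by omega) le_rfl ?_ (by omega)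
    ⟨ℓ, Or.inr rfl, by omega, by omega, Or.inr h3⟩
  intro i t hi1 hi2 hts hdvd
  left
  obtain rfl : i = 1 := by omega
  rw [one_mul] at hdvd ⊢
  have h1 : q ∣ (ℓ + s) - (ℓ + t) := Nat.dvd_sub hqn hdvd
  have := Nat.eq_zero_of_dvd_of_lt h1 (by omega)
  omega

theorem universallyGenerated_of_le_two {n : ℕ} (hn : n ≤ 2) : UniversallyGenerated n := by
  refine ⟨2, 2, Nat.prime_two, Nat.prime_two, fun H hH => ?_⟩
  have : Subsingleton (alternatingGroup (Fin n)) := by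
    constructor
    interval_cases n <;> decide
  exact absurd (Subsingleton.elim H ⊤) hH.ne

theorem universallyGenerated_of_primeFactors {n : ℕ}
    (h : (Nat.card (alternatingGroup (Fin n))).primeFactors ⊆ {2, 3}) :
    UniversallyGenerated n := by
  refine ⟨2, 3, Nat.prime_two, Nat.prime_three, fun H hH => ?_⟩
  have h1 : H.index ≠ 1 := fun h => hH.ne (Subgroup.index_eq_one.mp h)
  obtain ⟨r, hr, hrH⟩ := Nat.exists_prime_and_dvd h1
  have := h (Nat.mem_primeFactors.mpr ⟨hr, hrH.trans H.index_dvd_card, Nat.card_pos.ne'⟩)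
  simp only [Finset.mem_insert, Finset.mem_singleton] at this
  rcases this with rfl | rfl
  · exact Or.inl hrH
  · exact Or.inr hrH

theorem universallyGenerated_three : UniversallyGenerated 3 := by
  apply universallyGenerated_of_primeFactors
  have : 2 * Nat.card (alternatingGroup (Fin 3)) = Nat.card (Perm (Fin 3)) :=
    two_mul_nat_card_alternatingGroup
  rw [Nat.card_perm, Nat.card_fin] at this
  have h3 : Nat.card (alternatingGroup (Fin 3)) = 3 := by
    have : Nat.factorial 3 = 6 := rfl
    omega
  rw [h3, Nat.prime_three.primeFactors]
  simp

theorem universallyGenerated_four : UniversallyGenerated 4 := by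
  apply universallyGenerated_of_primeFactors
  have : 2 * Nat.card (alternatingGroup (Fin 4)) = Nat.card (Perm (Fin 4)) :=
    two_mul_nat_card_alternatingGroup
  rw [Nat.card_perm, Nat.card_fin] at this
  have h3 : Nat.card (alternatingGroup (Fin 4)) = 2 ^ 2 * 3 := by
    have : Nat.factorial 4 = 24 := rfl
    omega
  rw [h3, Nat.primeFactors_mul (by norm_num) (by norm_num), Nat.primeFactors_prime_pow (by norm_num)
    Nat.prime_two, Nat.prime_three.primeFactors]
  rfl

theorem universallyGenerated_five : UniversallyGenerated 5 := by
  refine universallyGenerated_of_witness (p := 5) (q := 5) (ℓ := 3) (c := 1) (s := 2) (a := 1)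
    (by norm_num) (by norm_num) (by norm_num) (by norm_num) (by norm_num) (by norm_num)
    (by norm_num) (by norm_num) (by norm_num) (by norm_num) (by norm_num) ?_ ?_
    ⟨3, by norm_num⟩
  · intro i t h1 h2 h3 h4
    omega
  · omega

theorem universallyGenerated_six : UniversallyGenerated 6 := by
  -- A 5-cycle fixes only one of six points, so the 3-cycle supplied by `p = 3` is used for Jordan's
  -- theorem.
  refine universallyGenerated_of_witness (p := 3) (q := 3) (ℓ := 5) (c := 1) (s := 1) (a := 1)
    (by norm_num) (by norm_num) (by norm_num) (by norm_num) (by norm_num) (by norm_num)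
    (by norm_num) (by norm_num) (by norm_num) (by norm_num) (by norm_num) ?_ ?_
    ⟨3, by norm_num⟩
  · intro i t h1 h2 h3 h4
    omega
  · omega

end Criterion

end PermutationGroups

/-! ### Tables and search procedures for the numerical verification -/

namespace KernelSearch

noncomputable section

set_option maxRecDepth 20000 in
/-- The primes from `7` to `31627`, in increasing order, cut into rows. -/
def primeRows : List (List ℕ) := [
  [7, 11, 13, 17, 19, 23, 29, 31, 37, 41, 43, 47, 53, 59, 61, 67, 71, 73, 79, 83, 89, 97, 101, 103, 107, 109, 113,
   127, 131, 137, 139, 149, 151, 157, 163, 167, 173, 179, 181, 191, 193, 197, 199, 211, 223, 227, 229, 233, 239, 241,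
   251, 257, 263, 269, 271, 277, 281, 283],
  [293, 307, 311, 313, 317, 331, 337, 347, 349, 353, 359, 367, 373, 379, 383, 389, 397, 401, 409, 419, 421, 431, 433,
   439, 443, 449, 457, 461, 463, 467, 479, 487, 491, 499, 503, 509, 521, 523, 541, 547, 557, 563, 569, 571, 577, 587,
   593, 599, 601, 607, 613, 617, 619, 631, 641, 643, 647, 653],
  [659, 661, 673, 677, 683, 691, 701, 709, 719, 727, 733, 739, 743, 751, 757, 761, 769, 773, 787, 797, 809, 811, 821,
   823, 827, 829, 839, 853, 857, 859, 863, 877, 881, 883, 887, 907, 911, 919, 929, 937, 941, 947, 953, 967, 971, 977,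
   983, 991, 997, 1009, 1013, 1019, 1021, 1031, 1033, 1039, 1049, 1051],
  [1061, 1063, 1069, 1087, 1091, 1093, 1097, 1103, 1109, 1117, 1123, 1129, 1151, 1153, 1163, 1171, 1181, 1187, 1193,
   1201, 1213, 1217, 1223, 1229, 1231, 1237, 1249, 1259, 1277, 1279, 1283, 1289, 1291, 1297, 1301, 1303, 1307, 1319,
   1321, 1327, 1361, 1367, 1373, 1381, 1399, 1409, 1423, 1427, 1429, 1433, 1439, 1447, 1451, 1453, 1459, 1471, 1481,
   1483],
  [1487, 1489, 1493, 1499, 1511, 1523, 1531, 1543, 1549, 1553, 1559, 1567, 1571, 1579, 1583, 1597, 1601, 1607, 1609,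
   1613, 1619, 1621, 1627, 1637, 1657, 1663, 1667, 1669, 1693, 1697, 1699, 1709, 1721, 1723, 1733, 1741, 1747, 1753,
   1759, 1777, 1783, 1787, 1789, 1801, 1811, 1823, 1831, 1847, 1861, 1867, 1871, 1873, 1877, 1879, 1889, 1901, 1907,
   1913],
  [1931, 1933, 1949, 1951, 1973, 1979, 1987, 1993, 1997, 1999, 2003, 2011, 2017, 2027, 2029, 2039, 2053, 2063, 2069,
   2081, 2083, 2087, 2089, 2099, 2111, 2113, 2129, 2131, 2137, 2141, 2143, 2153, 2161, 2179, 2203, 2207, 2213, 2221,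
   2237, 2239, 2243, 2251, 2267, 2269, 2273, 2281, 2287, 2293, 2297, 2309, 2311, 2333, 2339, 2341, 2347, 2351, 2357,
   2371],
  [2377, 2381, 2383, 2389, 2393, 2399, 2411, 2417, 2423, 2437, 2441, 2447, 2459, 2467, 2473, 2477, 2503, 2521, 2531,
   2539, 2543, 2549, 2551, 2557, 2579, 2591, 2593, 2609, 2617, 2621, 2633, 2647, 2657, 2659, 2663, 2671, 2677, 2683,
   2687, 2689, 2693, 2699, 2707, 2711, 2713, 2719, 2729, 2731, 2741, 2749, 2753, 2767, 2777, 2789, 2791, 2797, 2801,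
   2803],
  [2819, 2833, 2837, 2843, 2851, 2857, 2861, 2879, 2887, 2897, 2903, 2909, 2917, 2927, 2939, 2953, 2957, 2963, 2969,
   2971, 2999, 3001, 3011, 3019, 3023, 3037, 3041, 3049, 3061, 3067, 3079, 3083, 3089, 3109, 3119, 3121, 3137, 3163,
   3167, 3169, 3181, 3187, 3191, 3203, 3209, 3217, 3221, 3229, 3251, 3253, 3257, 3259, 3271, 3299, 3301, 3307, 3313,
   3319],
  [3323, 3329, 3331, 3343, 3347, 3359, 3361, 3371, 3373, 3389, 3391, 3407, 3413, 3433, 3449, 3457, 3461, 3463, 3467,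
   3469, 3491, 3499, 3511, 3517, 3527, 3529, 3533, 3539, 3541, 3547, 3557, 3559, 3571, 3581, 3583, 3593, 3607, 3613,
   3617, 3623, 3631, 3637, 3643, 3659, 3671, 3673, 3677, 3691, 3697, 3701, 3709, 3719, 3727, 3733, 3739, 3761, 3767,
   3769],
  [3779, 3793, 3797, 3803, 3821, 3823, 3833, 3847, 3851, 3853, 3863, 3877, 3881, 3889, 3907, 3911, 3917, 3919, 3923,
   3929, 3931, 3943, 3947, 3967, 3989, 4001, 4003, 4007, 4013, 4019, 4021, 4027, 4049, 4051, 4057, 4073, 4079, 4091,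
   4093, 4099, 4111, 4127, 4129, 4133, 4139, 4153, 4157, 4159, 4177, 4201, 4211, 4217, 4219, 4229, 4231, 4241, 4243,
   4253],
  [4259, 4261, 4271, 4273, 4283, 4289, 4297, 4327, 4337, 4339, 4349, 4357, 4363, 4373, 4391, 4397, 4409, 4421, 4423,
   4441, 4447, 4451, 4457, 4463, 4481, 4483, 4493, 4507, 4513, 4517, 4519, 4523, 4547, 4549, 4561, 4567, 4583, 4591,
   4597, 4603, 4621, 4637, 4639, 4643, 4649, 4651, 4657, 4663, 4673, 4679, 4691, 4703, 4721, 4723, 4729, 4733, 4751,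
   4759],
  [4783, 4787, 4789, 4793, 4799, 4801, 4813, 4817, 4831, 4861, 4871, 4877, 4889, 4903, 4909, 4919, 4931, 4933, 4937,
   4943, 4951, 4957, 4967, 4969, 4973, 4987, 4993, 4999, 5003, 5009, 5011, 5021, 5023, 5039, 5051, 5059, 5077, 5081,
   5087, 5099, 5101, 5107, 5113, 5119, 5147, 5153, 5167, 5171, 5179, 5189, 5197, 5209, 5227, 5231, 5233, 5237, 5261,
   5273],
  [5279, 5281, 5297, 5303, 5309, 5323, 5333, 5347, 5351, 5381, 5387, 5393, 5399, 5407, 5413, 5417, 5419, 5431, 5437,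
   5441, 5443, 5449, 5471, 5477, 5479, 5483, 5501, 5503, 5507, 5519, 5521, 5527, 5531, 5557, 5563, 5569, 5573, 5581,
   5591, 5623, 5639, 5641, 5647, 5651, 5653, 5657, 5659, 5669, 5683, 5689, 5693, 5701, 5711, 5717, 5737, 5741, 5743,
   5749],
  [5779, 5783, 5791, 5801, 5807, 5813, 5821, 5827, 5839, 5843, 5849, 5851, 5857, 5861, 5867, 5869, 5879, 5881, 5897,
   5903, 5923, 5927, 5939, 5953, 5981, 5987, 6007, 6011, 6029, 6037, 6043, 6047, 6053, 6067, 6073, 6079, 6089, 6091,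
   6101, 6113, 6121, 6131, 6133, 6143, 6151, 6163, 6173, 6197, 6199, 6203, 6211, 6217, 6221, 6229, 6247, 6257, 6263,
   6269],
  [6271, 6277, 6287, 6299, 6301, 6311, 6317, 6323, 6329, 6337, 6343, 6353, 6359, 6361, 6367, 6373, 6379, 6389, 6397,
   6421, 6427, 6449, 6451, 6469, 6473, 6481, 6491, 6521, 6529, 6547, 6551, 6553, 6563, 6569, 6571, 6577, 6581, 6599,
   6607, 6619, 6637, 6653, 6659, 6661, 6673, 6679, 6689, 6691, 6701, 6703, 6709, 6719, 6733, 6737, 6761, 6763, 6779,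
   6781],
  [6791, 6793, 6803, 6823, 6827, 6829, 6833, 6841, 6857, 6863, 6869, 6871, 6883, 6899, 6907, 6911, 6917, 6947, 6949,
   6959, 6961, 6967, 6971, 6977, 6983, 6991, 6997, 7001, 7013, 7019, 7027, 7039, 7043, 7057, 7069, 7079, 7103, 7109,
   7121, 7127, 7129, 7151, 7159, 7177, 7187, 7193, 7207, 7211, 7213, 7219, 7229, 7237, 7243, 7247, 7253, 7283, 7297,
   7307],
  [7309, 7321, 7331, 7333, 7349, 7351, 7369, 7393, 7411, 7417, 7433, 7451, 7457, 7459, 7477, 7481, 7487, 7489, 7499,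
   7507, 7517, 7523, 7529, 7537, 7541, 7547, 7549, 7559, 7561, 7573, 7577, 7583, 7589, 7591, 7603, 7607, 7621, 7639,
   7643, 7649, 7669, 7673, 7681, 7687, 7691, 7699, 7703, 7717, 7723, 7727, 7741, 7753, 7757, 7759, 7789, 7793, 7817,
   7823],
  [7829, 7841, 7853, 7867, 7873, 7877, 7879, 7883, 7901, 7907, 7919, 7927, 7933, 7937, 7949, 7951, 7963, 7993, 8009,
   8011, 8017, 8039, 8053, 8059, 8069, 8081, 8087, 8089, 8093, 8101, 8111, 8117, 8123, 8147, 8161, 8167, 8171, 8179,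
   8191, 8209, 8219, 8221, 8231, 8233, 8237, 8243, 8263, 8269, 8273, 8287, 8291, 8293, 8297, 8311, 8317, 8329, 8353,
   8363],
  [8369, 8377, 8387, 8389, 8419, 8423, 8429, 8431, 8443, 8447, 8461, 8467, 8501, 8513, 8521, 8527, 8537, 8539, 8543,
   8563, 8573, 8581, 8597, 8599, 8609, 8623, 8627, 8629, 8641, 8647, 8663, 8669, 8677, 8681, 8689, 8693, 8699, 8707,
   8713, 8719, 8731, 8737, 8741, 8747, 8753, 8761, 8779, 8783, 8803, 8807, 8819, 8821, 8831, 8837, 8839, 8849, 8861,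
   8863],
  [8867, 8887, 8893, 8923, 8929, 8933, 8941, 8951, 8963, 8969, 8971, 8999, 9001, 9007, 9011, 9013, 9029, 9041, 9043,
   9049, 9059, 9067, 9091, 9103, 9109, 9127, 9133, 9137, 9151, 9157, 9161, 9173, 9181, 9187, 9199, 9203, 9209, 9221,
   9227, 9239, 9241, 9257, 9277, 9281, 9283, 9293, 9311, 9319, 9323, 9337, 9341, 9343, 9349, 9371, 9377, 9391, 9397,
   9403],
  [9413, 9419, 9421, 9431, 9433, 9437, 9439, 9461, 9463, 9467, 9473, 9479, 9491, 9497, 9511, 9521, 9533, 9539, 9547,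
   9551, 9587, 9601, 9613, 9619, 9623, 9629, 9631, 9643, 9649, 9661, 9677, 9679, 9689, 9697, 9719, 9721, 9733, 9739,
   9743, 9749, 9767, 9769, 9781, 9787, 9791, 9803, 9811, 9817, 9829, 9833, 9839, 9851, 9857, 9859, 9871, 9883, 9887,
   9901],
  [9907, 9923, 9929, 9931, 9941, 9949, 9967, 9973, 10007, 10009, 10037, 10039, 10061, 10067, 10069, 10079, 10091,
   10093, 10099, 10103, 10111, 10133, 10139, 10141, 10151, 10159, 10163, 10169, 10177, 10181, 10193, 10211, 10223,
   10243, 10247, 10253, 10259, 10267, 10271, 10273, 10289, 10301, 10303, 10313, 10321, 10331, 10333, 10337, 10343,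
   10357, 10369, 10391, 10399, 10427, 10429, 10433, 10453, 10457],
  [10459, 10463, 10477, 10487, 10499, 10501, 10513, 10529, 10531, 10559, 10567, 10589, 10597, 10601, 10607, 10613,
   10627, 10631, 10639, 10651, 10657, 10663, 10667, 10687, 10691, 10709, 10711, 10723, 10729, 10733, 10739, 10753,
   10771, 10781, 10789, 10799, 10831, 10837, 10847, 10853, 10859, 10861, 10867, 10883, 10889, 10891, 10903, 10909,
   10937, 10939, 10949, 10957, 10973, 10979, 10987, 10993, 11003, 11027],
  [11047, 11057, 11059, 11069, 11071, 11083, 11087, 11093, 11113, 11117, 11119, 11131, 11149, 11159, 11161, 11171,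
   11173, 11177, 11197, 11213, 11239, 11243, 11251, 11257, 11261, 11273, 11279, 11287, 11299, 11311, 11317, 11321,
   11329, 11351, 11353, 11369, 11383, 11393, 11399, 11411, 11423, 11437, 11443, 11447, 11467, 11471, 11483, 11489,
   11491, 11497, 11503, 11519, 11527, 11549, 11551, 11579, 11587, 11593],
  [11597, 11617, 11621, 11633, 11657, 11677, 11681, 11689, 11699, 11701, 11717, 11719, 11731, 11743, 11777, 11779,
   11783, 11789, 11801, 11807, 11813, 11821, 11827, 11831, 11833, 11839, 11863, 11867, 11887, 11897, 11903, 11909,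
   11923, 11927, 11933, 11939, 11941, 11953, 11959, 11969, 11971, 11981, 11987, 12007, 12011, 12037, 12041, 12043,
   12049, 12071, 12073, 12097, 12101, 12107, 12109, 12113, 12119, 12143],
  [12149, 12157, 12161, 12163, 12197, 12203, 12211, 12227, 12239, 12241, 12251, 12253, 12263, 12269, 12277, 12281,
   12289, 12301, 12323, 12329, 12343, 12347, 12373, 12377, 12379, 12391, 12401, 12409, 12413, 12421, 12433, 12437,
   12451, 12457, 12473, 12479, 12487, 12491, 12497, 12503, 12511, 12517, 12527, 12539, 12541, 12547, 12553, 12569,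
   12577, 12583, 12589, 12601, 12611, 12613, 12619, 12637, 12641, 12647],
  [12653, 12659, 12671, 12689, 12697, 12703, 12713, 12721, 12739, 12743, 12757, 12763, 12781, 12791, 12799, 12809,
   12821, 12823, 12829, 12841, 12853, 12889, 12893, 12899, 12907, 12911, 12917, 12919, 12923, 12941, 12953, 12959,
   12967, 12973, 12979, 12983, 13001, 13003, 13007, 13009, 13033, 13037, 13043, 13049, 13063, 13093, 13099, 13103,
   13109, 13121, 13127, 13147, 13151, 13159, 13163, 13171, 13177, 13183],
  [13187, 13217, 13219, 13229, 13241, 13249, 13259, 13267, 13291, 13297, 13309, 13313, 13327, 13331, 13337, 13339,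
   13367, 13381, 13397, 13399, 13411, 13417, 13421, 13441, 13451, 13457, 13463, 13469, 13477, 13487, 13499, 13513,
   13523, 13537, 13553, 13567, 13577, 13591, 13597, 13613, 13619, 13627, 13633, 13649, 13669, 13679, 13681, 13687,
   13691, 13693, 13697, 13709, 13711, 13721, 13723, 13729, 13751, 13757],
  [13759, 13763, 13781, 13789, 13799, 13807, 13829, 13831, 13841, 13859, 13873, 13877, 13879, 13883, 13901, 13903,
   13907, 13913, 13921, 13931, 13933, 13963, 13967, 13997, 13999, 14009, 14011, 14029, 14033, 14051, 14057, 14071,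
   14081, 14083, 14087, 14107, 14143, 14149, 14153, 14159, 14173, 14177, 14197, 14207, 14221, 14243, 14249, 14251,
   14281, 14293, 14303, 14321, 14323, 14327, 14341, 14347, 14369, 14387],
  [14389, 14401, 14407, 14411, 14419, 14423, 14431, 14437, 14447, 14449, 14461, 14479, 14489, 14503, 14519, 14533,
   14537, 14543, 14549, 14551, 14557, 14561, 14563, 14591, 14593, 14621, 14627, 14629, 14633, 14639, 14653, 14657,
   14669, 14683, 14699, 14713, 14717, 14723, 14731, 14737, 14741, 14747, 14753, 14759, 14767, 14771, 14779, 14783,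
   14797, 14813, 14821, 14827, 14831, 14843, 14851, 14867, 14869, 14879],
  [14887, 14891, 14897, 14923, 14929, 14939, 14947, 14951, 14957, 14969, 14983, 15013, 15017, 15031, 15053, 15061,
   15073, 15077, 15083, 15091, 15101, 15107, 15121, 15131, 15137, 15139, 15149, 15161, 15173, 15187, 15193, 15199,
   15217, 15227, 15233, 15241, 15259, 15263, 15269, 15271, 15277, 15287, 15289, 15299, 15307, 15313, 15319, 15329,
   15331, 15349, 15359, 15361, 15373, 15377, 15383, 15391, 15401, 15413],
  [15427, 15439, 15443, 15451, 15461, 15467, 15473, 15493, 15497, 15511, 15527, 15541, 15551, 15559, 15569, 15581,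
   15583, 15601, 15607, 15619, 15629, 15641, 15643, 15647, 15649, 15661, 15667, 15671, 15679, 15683, 15727, 15731,
   15733, 15737, 15739, 15749, 15761, 15767, 15773, 15787, 15791, 15797, 15803, 15809, 15817, 15823, 15859, 15877,
   15881, 15887, 15889, 15901, 15907, 15913, 15919, 15923, 15937, 15959],
  [15971, 15973, 15991, 16001, 16007, 16033, 16057, 16061, 16063, 16067, 16069, 16073, 16087, 16091, 16097, 16103,
   16111, 16127, 16139, 16141, 16183, 16187, 16189, 16193, 16217, 16223, 16229, 16231, 16249, 16253, 16267, 16273,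
   16301, 16319, 16333, 16339, 16349, 16361, 16363, 16369, 16381, 16411, 16417, 16421, 16427, 16433, 16447, 16451,
   16453, 16477, 16481, 16487, 16493, 16519, 16529, 16547, 16553, 16561],
  [16567, 16573, 16603, 16607, 16619, 16631, 16633, 16649, 16651, 16657, 16661, 16673, 16691, 16693, 16699, 16703,
   16729, 16741, 16747, 16759, 16763, 16787, 16811, 16823, 16829, 16831, 16843, 16871, 16879, 16883, 16889, 16901,
   16903, 16921, 16927, 16931, 16937, 16943, 16963, 16979, 16981, 16987, 16993, 17011, 17021, 17027, 17029, 17033,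
   17041, 17047, 17053, 17077, 17093, 17099, 17107, 17117, 17123, 17137],
  [17159, 17167, 17183, 17189, 17191, 17203, 17207, 17209, 17231, 17239, 17257, 17291, 17293, 17299, 17317, 17321,
   17327, 17333, 17341, 17351, 17359, 17377, 17383, 17387, 17389, 17393, 17401, 17417, 17419, 17431, 17443, 17449,
   17467, 17471, 17477, 17483, 17489, 17491, 17497, 17509, 17519, 17539, 17551, 17569, 17573, 17579, 17581, 17597,
   17599, 17609, 17623, 17627, 17657, 17659, 17669, 17681, 17683, 17707],
  [17713, 17729, 17737, 17747, 17749, 17761, 17783, 17789, 17791, 17807, 17827, 17837, 17839, 17851, 17863, 17881,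
   17891, 17903, 17909, 17911, 17921, 17923, 17929, 17939, 17957, 17959, 17971, 17977, 17981, 17987, 17989, 18013,
   18041, 18043, 18047, 18049, 18059, 18061, 18077, 18089, 18097, 18119, 18121, 18127, 18131, 18133, 18143, 18149,
   18169, 18181, 18191, 18199, 18211, 18217, 18223, 18229, 18233, 18251],
  [18253, 18257, 18269, 18287, 18289, 18301, 18307, 18311, 18313, 18329, 18341, 18353, 18367, 18371, 18379, 18397,
   18401, 18413, 18427, 18433, 18439, 18443, 18451, 18457, 18461, 18481, 18493, 18503, 18517, 18521, 18523, 18539,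
   18541, 18553, 18583, 18587, 18593, 18617, 18637, 18661, 18671, 18679, 18691, 18701, 18713, 18719, 18731, 18743,
   18749, 18757, 18773, 18787, 18793, 18797, 18803, 18839, 18859, 18869],
  [18899, 18911, 18913, 18917, 18919, 18947, 18959, 18973, 18979, 19001, 19009, 19013, 19031, 19037, 19051, 19069,
   19073, 19079, 19081, 19087, 19121, 19139, 19141, 19157, 19163, 19181, 19183, 19207, 19211, 19213, 19219, 19231,
   19237, 19249, 19259, 19267, 19273, 19289, 19301, 19309, 19319, 19333, 19373, 19379, 19381, 19387, 19391, 19403,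
   19417, 19421, 19423, 19427, 19429, 19433, 19441, 19447, 19457, 19463],
  [19469, 19471, 19477, 19483, 19489, 19501, 19507, 19531, 19541, 19543, 19553, 19559, 19571, 19577, 19583, 19597,
   19603, 19609, 19661, 19681, 19687, 19697, 19699, 19709, 19717, 19727, 19739, 19751, 19753, 19759, 19763, 19777,
   19793, 19801, 19813, 19819, 19841, 19843, 19853, 19861, 19867, 19889, 19891, 19913, 19919, 19927, 19937, 19949,
   19961, 19963, 19973, 19979, 19991, 19993, 19997, 20011, 20021, 20023],
  [20029, 20047, 20051, 20063, 20071, 20089, 20101, 20107, 20113, 20117, 20123, 20129, 20143, 20147, 20149, 20161,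
   20173, 20177, 20183, 20201, 20219, 20231, 20233, 20249, 20261, 20269, 20287, 20297, 20323, 20327, 20333, 20341,
   20347, 20353, 20357, 20359, 20369, 20389, 20393, 20399, 20407, 20411, 20431, 20441, 20443, 20477, 20479, 20483,
   20507, 20509, 20521, 20533, 20543, 20549, 20551, 20563, 20593, 20599],
  [20611, 20627, 20639, 20641, 20663, 20681, 20693, 20707, 20717, 20719, 20731, 20743, 20747, 20749, 20753, 20759,
   20771, 20773, 20789, 20807, 20809, 20849, 20857, 20873, 20879, 20887, 20897, 20899, 20903, 20921, 20929, 20939,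
   20947, 20959, 20963, 20981, 20983, 21001, 21011, 21013, 21017, 21019, 21023, 21031, 21059, 21061, 21067, 21089,
   21101, 21107, 21121, 21139, 21143, 21149, 21157, 21163, 21169, 21179],
  [21187, 21191, 21193, 21211, 21221, 21227, 21247, 21269, 21277, 21283, 21313, 21317, 21319, 21323, 21341, 21347,
   21377, 21379, 21383, 21391, 21397, 21401, 21407, 21419, 21433, 21467, 21481, 21487, 21491, 21493, 21499, 21503,
   21517, 21521, 21523, 21529, 21557, 21559, 21563, 21569, 21577, 21587, 21589, 21599, 21601, 21611, 21613, 21617,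
   21647, 21649, 21661, 21673, 21683, 21701, 21713, 21727, 21737, 21739],
  [21751, 21757, 21767, 21773, 21787, 21799, 21803, 21817, 21821, 21839, 21841, 21851, 21859, 21863, 21871, 21881,
   21893, 21911, 21929, 21937, 21943, 21961, 21977, 21991, 21997, 22003, 22013, 22027, 22031, 22037, 22039, 22051,
   22063, 22067, 22073, 22079, 22091, 22093, 22109, 22111, 22123, 22129, 22133, 22147, 22153, 22157, 22159, 22171,
   22189, 22193, 22229, 22247, 22259, 22271, 22273, 22277, 22279, 22283],
  [22291, 22303, 22307, 22343, 22349, 22367, 22369, 22381, 22391, 22397, 22409, 22433, 22441, 22447, 22453, 22469,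
   22481, 22483, 22501, 22511, 22531, 22541, 22543, 22549, 22567, 22571, 22573, 22613, 22619, 22621, 22637, 22639,
   22643, 22651, 22669, 22679, 22691, 22697, 22699, 22709, 22717, 22721, 22727, 22739, 22741, 22751, 22769, 22777,
   22783, 22787, 22807, 22811, 22817, 22853, 22859, 22861, 22871, 22877],
  [22901, 22907, 22921, 22937, 22943, 22961, 22963, 22973, 22993, 23003, 23011, 23017, 23021, 23027, 23029, 23039,
   23041, 23053, 23057, 23059, 23063, 23071, 23081, 23087, 23099, 23117, 23131, 23143, 23159, 23167, 23173, 23189,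
   23197, 23201, 23203, 23209, 23227, 23251, 23269, 23279, 23291, 23293, 23297, 23311, 23321, 23327, 23333, 23339,
   23357, 23369, 23371, 23399, 23417, 23431, 23447, 23459, 23473, 23497],
  [23509, 23531, 23537, 23539, 23549, 23557, 23561, 23563, 23567, 23581, 23593, 23599, 23603, 23609, 23623, 23627,
   23629, 23633, 23663, 23669, 23671, 23677, 23687, 23689, 23719, 23741, 23743, 23747, 23753, 23761, 23767, 23773,
   23789, 23801, 23813, 23819, 23827, 23831, 23833, 23857, 23869, 23873, 23879, 23887, 23893, 23899, 23909, 23911,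
   23917, 23929, 23957, 23971, 23977, 23981, 23993, 24001, 24007, 24019],
  [24023, 24029, 24043, 24049, 24061, 24071, 24077, 24083, 24091, 24097, 24103, 24107, 24109, 24113, 24121, 24133,
   24137, 24151, 24169, 24179, 24181, 24197, 24203, 24223, 24229, 24239, 24247, 24251, 24281, 24317, 24329, 24337,
   24359, 24371, 24373, 24379, 24391, 24407, 24413, 24419, 24421, 24439, 24443, 24469, 24473, 24481, 24499, 24509,
   24517, 24527, 24533, 24547, 24551, 24571, 24593, 24611, 24623, 24631],
  [24659, 24671, 24677, 24683, 24691, 24697, 24709, 24733, 24749, 24763, 24767, 24781, 24793, 24799, 24809, 24821,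
   24841, 24847, 24851, 24859, 24877, 24889, 24907, 24917, 24919, 24923, 24943, 24953, 24967, 24971, 24977, 24979,
   24989, 25013, 25031, 25033, 25037, 25057, 25073, 25087, 25097, 25111, 25117, 25121, 25127, 25147, 25153, 25163,
   25169, 25171, 25183, 25189, 25219, 25229, 25237, 25243, 25247, 25253],
  [25261, 25301, 25303, 25307, 25309, 25321, 25339, 25343, 25349, 25357, 25367, 25373, 25391, 25409, 25411, 25423,
   25439, 25447, 25453, 25457, 25463, 25469, 25471, 25523, 25537, 25541, 25561, 25577, 25579, 25583, 25589, 25601,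
   25603, 25609, 25621, 25633, 25639, 25643, 25657, 25667, 25673, 25679, 25693, 25703, 25717, 25733, 25741, 25747,
   25759, 25763, 25771, 25793, 25799, 25801, 25819, 25841, 25847, 25849],
  [25867, 25873, 25889, 25903, 25913, 25919, 25931, 25933, 25939, 25943, 25951, 25969, 25981, 25997, 25999, 26003,
   26017, 26021, 26029, 26041, 26053, 26083, 26099, 26107, 26111, 26113, 26119, 26141, 26153, 26161, 26171, 26177,
   26183, 26189, 26203, 26209, 26227, 26237, 26249, 26251, 26261, 26263, 26267, 26293, 26297, 26309, 26317, 26321,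
   26339, 26347, 26357, 26371, 26387, 26393, 26399, 26407, 26417, 26423],
  [26431, 26437, 26449, 26459, 26479, 26489, 26497, 26501, 26513, 26539, 26557, 26561, 26573, 26591, 26597, 26627,
   26633, 26641, 26647, 26669, 26681, 26683, 26687, 26693, 26699, 26701, 26711, 26713, 26717, 26723, 26729, 26731,
   26737, 26759, 26777, 26783, 26801, 26813, 26821, 26833, 26839, 26849, 26861, 26863, 26879, 26881, 26891, 26893,
   26903, 26921, 26927, 26947, 26951, 26953, 26959, 26981, 26987, 26993],
  [27011, 27017, 27031, 27043, 27059, 27061, 27067, 27073, 27077, 27091, 27103, 27107, 27109, 27127, 27143, 27179,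
   27191, 27197, 27211, 27239, 27241, 27253, 27259, 27271, 27277, 27281, 27283, 27299, 27329, 27337, 27361, 27367,
   27397, 27407, 27409, 27427, 27431, 27437, 27449, 27457, 27479, 27481, 27487, 27509, 27527, 27529, 27539, 27541,
   27551, 27581, 27583, 27611, 27617, 27631, 27647, 27653, 27673, 27689],
  [27691, 27697, 27701, 27733, 27737, 27739, 27743, 27749, 27751, 27763, 27767, 27773, 27779, 27791, 27793, 27799,
   27803, 27809, 27817, 27823, 27827, 27847, 27851, 27883, 27893, 27901, 27917, 27919, 27941, 27943, 27947, 27953,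
   27961, 27967, 27983, 27997, 28001, 28019, 28027, 28031, 28051, 28057, 28069, 28081, 28087, 28097, 28099, 28109,
   28111, 28123, 28151, 28163, 28181, 28183, 28201, 28211, 28219, 28229],
  [28277, 28279, 28283, 28289, 28297, 28307, 28309, 28319, 28349, 28351, 28387, 28393, 28403, 28409, 28411, 28429,
   28433, 28439, 28447, 28463, 28477, 28493, 28499, 28513, 28517, 28537, 28541, 28547, 28549, 28559, 28571, 28573,
   28579, 28591, 28597, 28603, 28607, 28619, 28621, 28627, 28631, 28643, 28649, 28657, 28661, 28663, 28669, 28687,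
   28697, 28703, 28711, 28723, 28729, 28751, 28753, 28759, 28771, 28789],
  [28793, 28807, 28813, 28817, 28837, 28843, 28859, 28867, 28871, 28879, 28901, 28909, 28921, 28927, 28933, 28949,
   28961, 28979, 29009, 29017, 29021, 29023, 29027, 29033, 29059, 29063, 29077, 29101, 29123, 29129, 29131, 29137,
   29147, 29153, 29167, 29173, 29179, 29191, 29201, 29207, 29209, 29221, 29231, 29243, 29251, 29269, 29287, 29297,
   29303, 29311, 29327, 29333, 29339, 29347, 29363, 29383, 29387, 29389],
  [29399, 29401, 29411, 29423, 29429, 29437, 29443, 29453, 29473, 29483, 29501, 29527, 29531, 29537, 29567, 29569,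
   29573, 29581, 29587, 29599, 29611, 29629, 29633, 29641, 29663, 29669, 29671, 29683, 29717, 29723, 29741, 29753,
   29759, 29761, 29789, 29803, 29819, 29833, 29837, 29851, 29863, 29867, 29873, 29879, 29881, 29917, 29921, 29927,
   29947, 29959, 29983, 29989, 30011, 30013, 30029, 30047, 30059, 30071],
  [30089, 30091, 30097, 30103, 30109, 30113, 30119, 30133, 30137, 30139, 30161, 30169, 30181, 30187, 30197, 30203,
   30211, 30223, 30241, 30253, 30259, 30269, 30271, 30293, 30307, 30313, 30319, 30323, 30341, 30347, 30367, 30389,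
   30391, 30403, 30427, 30431, 30449, 30467, 30469, 30491, 30493, 30497, 30509, 30517, 30529, 30539, 30553, 30557,
   30559, 30577, 30593, 30631, 30637, 30643, 30649, 30661, 30671, 30677],
  [30689, 30697, 30703, 30707, 30713, 30727, 30757, 30763, 30773, 30781, 30803, 30809, 30817, 30829, 30839, 30841,
   30851, 30853, 30859, 30869, 30871, 30881, 30893, 30911, 30931, 30937, 30941, 30949, 30971, 30977, 30983, 31013,
   31019, 31033, 31039, 31051, 31063, 31069, 31079, 31081, 31091, 31121, 31123, 31139, 31147, 31151, 31153, 31159,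
   31177, 31181, 31183, 31189, 31193, 31219, 31223, 31231, 31237, 31247],
  [31249, 31253, 31259, 31267, 31271, 31277, 31307, 31319, 31321, 31327, 31333, 31337, 31357, 31379, 31387, 31391,
   31393, 31397, 31469, 31477, 31481, 31489, 31511, 31513, 31517, 31531, 31541, 31543, 31547, 31567, 31573, 31583,
   31601, 31607, 31627]]

set_option maxRecDepth 20000 in
/-- The row with index `i` contains `(m, g, v)` if `g * m = i + 4` is a prime power, at least `79`;
here `g` is the greatest common divisor of that prime power and `30`, and `v` is the inverse of
`-30 / g` modulo `m`. -/
def sieveTable : List (List (ℕ × ℕ × ℕ)) := [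
  [], [], [], [], [], [], [], [], [], [], [], [], [], [], [], [], [], [], [], [], [], [], [], [], [], [], [], [], [],
  [], [], [], [], [], [], [], [], [], [], [], [], [], [], [], [], [], [], [], [], [], [], [], [], [], [], [], [], [],
  [], [], [], [], [], [], [], [], [], [], [], [], [], [], [], [], [], [(79, 1, 50)], [], [(27, 3, 8)], [], [(83, 1,
  47)], [], [], [], [], [], [(89, 1, 86)], [], [], [], [], [], [], [], [(97, 1, 42)], [], [], [], [(101, 1, 37)], [],
  [(103, 1, 24)], [], [], [], [(107, 1, 82)], [], [(109, 1, 69)], [], [], [], [(113, 1, 64)], [], [], [], [], [], [],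
  [], [(121, 1, 4)], [], [], [], [(25, 5, 4)], [], [(127, 1, 55)], [(64, 2, 17)], [], [], [(131, 1, 48)], [], [], [],
  [], [], [(137, 1, 105)], [], [(139, 1, 88)], [], [], [], [], [], [], [], [], [], [(149, 1, 144)], [], [(151, 1, 5)],
  [], [], [], [], [], [(157, 1, 68)], [], [], [], [], [], [(163, 1, 38)], [], [], [], [(167, 1, 128)], [], [(169, 1,
  107)], [], [], [], [(173, 1, 98)], [], [], [], [], [], [(179, 1, 173)], [], [(181, 1, 6)], [], [], [], [], [], [],
  [], [], [], [(191, 1, 70)], [], [(193, 1, 45)], [], [], [], [(197, 1, 151)], [], [(199, 1, 126)], [], [], [], [],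
  [], [], [], [], [], [], [], [(211, 1, 7)], [], [], [], [], [], [], [], [], [], [], [], [(223, 1, 52)], [], [], [],
  [(227, 1, 174)], [], [(229, 1, 145)], [], [], [], [(233, 1, 132)], [], [], [], [], [], [(239, 1, 231)], [], [(241,
  1, 8)], [], [(81, 3, 8)], [], [], [], [], [], [], [], [(251, 1, 92)], [], [], [], [], [(128, 2, 17)], [(257, 1,
  197)], [], [], [], [], [], [(263, 1, 149)], [], [], [], [], [], [(269, 1, 260)], [], [(271, 1, 9)], [], [], [], [],
  [], [(277, 1, 120)], [], [], [], [(281, 1, 103)], [], [(283, 1, 66)]]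

/-- The `11` bits from the place `11 * (2 ^ k % 2053)` on are those of `k`, for `k < 2048`. -/
def logTable : ℕ :=
  0x4028072720200b93a9f202d360185de4f1be4fa29603116a6f8d006b162f0f624fc1837f7413f55214c1aa03a1122fa269c7b7c6a9600708362e364bc93f7b2cba500f68326c0e0427ba36113feceaa685c53e010d6ec2045cb4240cc8c472d14d369cab8f712cb1b7f54b391407e6a1085898c5231b57b0bd0c52800e1ed10465e8f6508f01eeaae0d2043639c4e0f23850776e9305b0a135400fdd9ff96aa2f2431e50546f0c0447436021763c5204973b9835509cae0687648cf608e7d9345bc869dcde9d15b572643dcb96967e1b1ba4afed1dd2d2e0c8d30408252cd715842e1e2c71718cf7ea49da06db3cbdaa48bdab118c684a0ef8073a6dedbc020ba3d9844a47dcae511111e39947c156558e920d8cd40af30d9490ce5430e13a9e48b0214be73bd39ae9ee860cd4ac36d609da9d40d4c1fcb6b682d1fcc22eaa8455e7ced0cedff2bf1c54c20de3c1301d0323cfc0369fc0454f9d914de2b6f6054992e98c6e6e861ac6b50a03095e57c1aaa83b5f888d0d2ec26363a453eca67b46662792af5a7ad7e71c069de2e2b86295d187323893dd34572e6525a757f0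ea7b1c20a49789ffbf0b8f07c92ddf95c3ef723ae9984b1c08a774a6d23361d48aee7c431a8c3ee68b20e78bb1018d3d1efe65e92de3ed3dd06e07b67b2def77ec526e30be530565d686382a3445a4a1062df3e281d6c5d38bedee1b7782a8483325d202ed98b0e8978ed1ffaee591a251bfe224834795c7ccc3b07c96f2ae9395690d74b5220e49519d8a90327379b4b0d9bfa923feb39891a1b5bce1ffe755c3b92db758318a1512c7d11eceffd19cf6a2ea677dd27d583e0a6a7d16c3a2adae97827cd2d510c141095a9b7f07f81c5b7117689485a4b93f3fa9119336ab51108df017a6b1e78de90d652dc192bcb55bf90d7055573842bb3794fde0ac7f024f0a093148fa667e3ae0371c73fab2811cf6a7f20dd9e1129c0538b516b7c4ca058009349e8ba8a3c64f5ae7068d0e9586bb2c35d6090abae062d2e586432c17a81b23b5539bced84bfc7e488df121a675fb173531de123acbf8a916bb329033fa6746f29cc6e89e550a57d391a86a55b02279cfc5e04fba9e5bbc5e6acaefe03166715deff311888c929cc4a7c3ddac568ce75cc43e32bdca5ab8aeb059fc42f953e2e71cc664163a926546c514abfc56de191823cda63e7d0d2e42ebf510d714cbf7cde32435a5d4c7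661eb6591204091304f0f512a5806937a336f903abe0a2c69774138843bec35266b101ee737dc0b28b71d14a22f741882dd98dc7f7a579bc04e0331dba93374bc9db3b5369eeadac6e9e30f9ddd9f125970db6f7d9bfda37d4a37f71a794befd5a621f959f1eeb7de464040056d00d185d2d449ca1ceb0c72eb7d568f16dbc1df9ed8d7c74ea1f5f9675eedac371fbde148a54438483fa364ca5b48857178e05995d861ee3e2626cc7879d2074cf5e5ff96e578d3f5e5267b7ff4cc89c1541c20079ecbb90ad7338c21dbc807d6ed2e1d74ac24749fded573bd21c329d36e5a9210a0e9f992c0b467e5fc56d0903df64e8695e7078a5a17cda30b7f65b2493f7ff64a73a2271245168764fae13b4e260effe195d5a38e1f2f3936a2b71bf1613878c75aa15b5725be35f48b48f8dc4f0598fa40f67479bb53e82eaf49cf1b23753ba3ed7cd84224c17a7daa595e8c886c458b456bfb6c6be4bf67c2858e9a6f7f54d608636b941a2e12c6eaa713bbfbfc48030103af116e33888d233696db292a9169f535ca38ff46c1f5442446fcd99de96aba62a24ca023a8cf82a617ada2d65a4f9eb656f61650d853ca62fb70874c96e0fcbd91ab8cd3e4b616bb76855cd6ae8c461151e5dae4779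be29fd13b835de6409bb02eac9e38fa82c3998c7a4905634ce909f90afd73d3837c34391ec4ff618596604125b19efcbea04da909965da286c251aca79cd02bf678ba31a2f29adfd782679f6060990010064d80a4f74d4bb1bd14845719b157af05ee7d510d2843447b64ae2086c13e65a3d4d7c26b07b350b60075f72819471698ade58ff4c899a4b0d22bd63101b9034783bd55203ce1c88ee3040983f3f22f1f27bbc8e020e265c86a4ad3b1d7fb1bc7e6c568c7b95f0a9263b2df9809462ae1d8b7df7b3b3b522ac0d06f7d34eff47449e5444332155746331e5c8fa16ea15fbe69cbb9da8ed5d4d52d6cad01141139d6def8d07f81d027de7ee9e94cb79263186853580bcaf2a7fc2344c645233b9855e2d6e018b4c4986c46d10c9f5653a8271370a3e37e3de2e858c9d9a39d373c69dcc8e687ef40cb5e2ee61ea5b7eb7174bfac8292d0187c4ec45f46d950324174c371d7ad8ceff5065c61d65b92690ca8f25314a72a56fe7fc890addff786db68c24ae3d7d0b4f9d8fa609e888a52ecd185e252fd81b88851d71fa8999443dfeb06f394724d5a6b75c975cfc63d3be62265d6e71964cf590584009d152620013c8a27aa19d2ab2bb02eb5a5642bd28eb3704af23c44eb734f072fa2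ca8fd31ca1d0d099c7a90447c47db6e8d57df337bfb10a9b3deb11ce43dee2e24b32f817119474d45a535b22fda5e850b6214ca6eed658e6b59004bde9d7fbcfe3fc0e969c2faccc9edede2da93f406eb1faf2cdfedadcfb5b686d478bbb1246d96686f37e3c9f503ef1def00fd9f85c24d3aa5cd676dde76f821eb396aff74891c1e894a85670175dc726b3cdd2cbf656fad9ea994140ffb295a0c1e3fbb3ae246ef4ef064ee40827e01665e6837d4d20770bcc28b5bf6250898a264e9d983432237977a877db86ad2d5bc60b36e165c1e79af3fd2363bb9be488f4f5944416297eebdb3d635ef55fb5a8b4dc93afe0c01e1b37917b6951f521c5b00847ccf4898593a8b52f687493640b01485e87370564199b60bb33558851d720f8626ddd4dbaaf1ec383d1589208aee9b0cfd86173016c3974d9cb0a16351ccfb08c252d77cf826200009a686f08a31482d54107fb51024f47a425d997fee4c7056dfcf3452118640877202e42c0c7daf0ddc07cb8cacebcf18acb94490b792861cef8ce957ef677d12087954197239d3be5dcdb52a52cf087b760f5013f452e4be8405ca9868451cc0b5716185687d5504709beeb9d3a9d234c395e7de10f3faa970280c1b0cdab23619eb1fe5c52da42e49a717f023ffe5b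5255f3f3ae084513404981a28de9e87eafca1566b8cfb9dc990e2cf4c1f450000a10ccca9d66414721278873397aa3b93d08d47f0edcfdedfaa6961c3c710bde32544ad7692164c96b1ad09757ef1da55f51ec16bcfe3ecde6e4d9cf0923b32df7e9f1c07c16e74d66f38876d5488f42156eb26ae959573cc13d9230375a45777b8cfbe5dbe81d984bf544b93706236d40e15aa8b2b2de67a3bb844564ec4ebcb19579161395fecdb6cf51d7ff2d3028ab40d8c28872b1ed7e6a51c7c177355437ac22b619616b5f361421cb45f5d84b808376c4ea7fb4279092ff46ffe548080a01604bbc0f4ab78ae4d6ee1b673bd62395391af9369acedb9400a568354b1416a184ea9c21731d11c9783f4827d84c8bd5dc42149c0475b4f9d81e67819f4dabaac4fa4c73ce898a06539002473251b41fe17dd5330ed7b543b4732359d7dd287af9f4dd6cc489be71b0b55950e4870a89a72a41217e9137165c0eafd3262357082c7cc3b7b25aeeae93866bd43e52896c41c5af51bbb70d8566159ae72aba807625ece11c6ea3e801774aa72586b7a1527c6b367fe8289e60f839d0bbe09990dc34df6cf03018d5b3e67909fc7fcc6837dc87550a63d7c3d537090f1aac92193441148796df9a34160edb5d137e9ea2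03851a86b850e4806f651b4ffca9c325456668130473c12dc2b6405e7c09ee61f6ea0d7b9b7c6642c10cb48cdda93650f467098058d92a0a868039d7040b09dfb55eb8c40f4644d68c00494f9fee009caf30389a003cfc26e0680213400400000

/-- The bare recursor makes kernel reduction settle `a` first and skip `b` when `a` is false; the
functions below are written in this style for the same reason. -/
def both (a b : Bool) : Bool := Bool.rec false b a

def either (a b : Bool) : Bool := Bool.rec b true a

def allOf {α : Type} (f : α → Bool) (l : List α) : Bool :=
  List.rec true (fun a _ ih => both (f a) ih) l

def anyOf {α : Type} (f : α → Bool) (l : List α) : Bool :=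
  List.rec false (fun a _ ih => either (f a) ih) l

def foldOf {α β : Type} (g : α → β → β) (b : β) (l : List α) : β :=
  List.rec b (fun a _ ih => g a ih) l

/-- `f x`, arranged so that the kernel evaluates `x` to a numeral before it unfolds `f`. -/
def force {α : Type} (f : ℕ → α) (x : ℕ) : α := Nat.rec (f 0) (fun a _ => f a) (Nat.succ x)

/-- `f` holds on the `2 ^ d` numbers from `2 ^ d * j` on. -/
def allDyadic (f : ℕ → Bool) (d : ℕ) : ℕ → Bool :=
  Nat.rec (fun j => f j)
    (fun _ ih j => both (ih (Nat.mul 2 j)) (ih (Nat.succ (Nat.mul 2 j)))) d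

def upTo (f : ℕ → Bool) (c : ℕ) : Bool := Nat.rec true (fun k ih => both (f (Nat.succ k)) ih) c

/-- The product of the primes up to `31627`. -/
def primeProd : ℕ :=
  Nat.mul 30 (foldOf (fun r acc => Nat.mul (foldOf Nat.mul 1 r) acc) 1 primeRows)

/-- `x` is coprime to all primes up to `31627`. -/
def rough (x : ℕ) : Bool := Nat.beq (Nat.gcd (Nat.mod primeProd x) x) 1

def smallPrimes : List ℕ := [2, 3, 5, 7, 11, 13, 17, 19, 23, 29, 31, 37, 41, 43, 47, 53, 59, 61,
  67, 71, 73, 79, 83, 89, 97, 101, 103, 107, 109, 113, 127, 131, 137, 139, 149, 151, 157, 163, 167,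
  173]

/-- Trial division by a single gcd, meant for `x < 179 ^ 2 = 32041`. Up to 178 the gcd would detect
`x` itself, so membership in the list is tested. -/
def smallPrimeTest (x : ℕ) : Bool :=
  Bool.rec (Nat.beq (Nat.gcd (foldOf Nat.mul 1 smallPrimes) x) 1) (anyOf (Nat.beq x) smallPrimes)
    (Nat.ble x 178)

/-- `rough` rejects the primes up to 31627 because they divide `primeProd`, so these need the other
test. -/
def primeTest (x : ℕ) : Bool := Bool.rec (rough x) (smallPrimeTest x) (Nat.ble x 31627)

/-! ### Sieving -/

/-- Has the bits `p * j` for `j < J`. -/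
def progression (p : ℕ) (fuel : ℕ) : ℕ → ℕ :=
  Nat.rec (fun _ => 1)
    (fun _ ih J => Bool.rec
      (Nat.lor (ih (Nat.div (Nat.succ J) 2))
        (Nat.shiftLeft (ih (Nat.div (Nat.succ J) 2)) (Nat.mul p (Nat.div J 2))))
      1 (Nat.ble J 1)) fuel

def multiples (L p : ℕ) : ℕ := progression p 32 (Nat.succ (Nat.div L p))

/-- The inverse of `-30` modulo a prime `p > 5`. -/
def negInv (p : ℕ) : ℕ := Nat.div (Nat.mul p (Nat.mod (Nat.pow p 3) 30)) 30

def base (i p : ℕ) : ℕ := Nat.mul (Nat.sub p 1) i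

def rowComposites (L i a : ℕ) (r : List ℕ) : ℕ :=
  List.rec 0 (fun p _ acc => Nat.lor (Nat.shiftLeft (multiples L p)
    (Nat.mod (Nat.add (Nat.mul a (negInv p)) (base i p)) p)) acc) r

/-- The bit `j` is set if `30 * (i + j) + a` is composite. -/
def composites (L i a : ℕ) : ℕ :=
  List.rec 0 (fun r _ ih => Bool.rec ih (Nat.lor (rowComposites L i a r) ih)
      (Nat.ble (Nat.mul (List.headD r 0) (List.headD r 0)) (Nat.mul 30 (Nat.add i L))))
    primeRows

/-- For `e = (m, g, v)`, the bit `j` is set if `30 * (i + j) + ρ` is divisible by `g * m`. -/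
def divides (L i ρ : ℕ) (e : ℕ × ℕ × ℕ) : ℕ :=
  Bool.rec 0 (Nat.shiftLeft (multiples L e.1)
    (Nat.mod (Nat.add (Nat.mul e.2.2 (Nat.div ρ e.2.1)) (Nat.mul (Nat.sub e.1 1) i)) e.1))
    (Nat.beq (Nat.mod ρ e.2.1) 0)

def addDivisors (L i ρ X : ℕ) (e : List (ℕ × ℕ × ℕ)) : ℕ :=
  List.rec X (fun x _ acc => Nat.lor (divides L i ρ x) acc) e

/-- Let `n = 30 * (i + j) + ρ` and `d = ρ + 300 - δ`, and let the rows of `t` list the prime powers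
among `δ + 1, δ + 2, …`. The bit `j` is clear only if `n - δ'` is prime for some `δ' ≥ δ` such that
`n` is divisible by no listed prime power up to `δ'`. -/
def exceptFrom (L i ρ : ℕ) (t : List (List (ℕ × ℕ × ℕ))) : ℕ → ℕ :=
  List.rec (motive := fun _ => ℕ → ℕ) (fun _ => Nat.sub (Nat.pow 2 L) 1)
    (fun e _ ih => force (fun d => Bool.rec (addDivisors L i ρ (ih (Nat.sub d 1)) e)
      (Nat.land (Nat.shiftLeft (force (composites L i) (Nat.mod d 30)) (Nat.sub 10 (Nat.div d 30)))
        (addDivisors L i ρ (ih (Nat.sub d 1)) e)) (Nat.beq (Nat.gcd d 30) 1))) t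

/-- The start `ρ + 297` is distance 3, the least that Jordan's theorem admits. The eleven lowest
blocks are dropped: the sieve looks back over up to ten blocks and the search for prime gaps over
eleven. -/
def exceptions (L i ρ : ℕ) : ℕ :=
  Nat.shiftRight (Nat.mod (exceptFrom L i ρ sieveTable (Nat.add ρ 297)) (Nat.pow 2 L)) 11

def emptyBlocks (L i : ℕ) : ℕ :=
  foldOf (fun a acc => Nat.land (force (composites L i) a) acc) (Nat.sub (Nat.pow 2 L) 1)
    [1, 7, 11, 13, 17, 19, 23, 29]

def run2 (x : ℕ) : ℕ := Nat.land x (Nat.shiftLeft x 1)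

/-- Applied to pairs of adjacent bits, the shifts 0, 2, 4, 6, 8 cover ten consecutive bits. -/
def run10 (y : ℕ) : ℕ :=
  Nat.land (Nat.land (Nat.land y (Nat.shiftLeft y 2))
    (Nat.land (Nat.shiftLeft y 4) (Nat.shiftLeft y 6))) (Nat.shiftLeft y 8)

def noGap (L i : ℕ) : Bool :=
  Nat.beq (Nat.shiftRight (Nat.mod (run10 (run2 (emptyBlocks L i))) (Nat.pow 2 L)) 9) 0

/-! ### Running through the bits of a number -/

def dropBit (G : ℕ) : ℕ := Nat.land G (Nat.sub G 1)

/-- `G - dropBit G` is the lowest power of two in `G`, and its exponent is read off as a discrete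
logarithm modulo 2053. Nothing about the table has to be proved, since `bitsAll` checks that
restoring the bit gives back `G`. -/
def lowIndex (G : ℕ) : ℕ :=
  Nat.mod (Nat.shiftRight logTable (Nat.mul 11 (Nat.mod (Nat.sub G (dropBit G)) 2053))) 2048

def bitsAll (f : ℕ → ℕ → Bool) (u : ℕ) : ℕ → Bool :=
  Nat.rec (fun _ => false) (fun _ ih G => Bool.rec (Bool.rec false
    (Bool.rec false (ih (dropBit G)) (f u (lowIndex G)))
    (Nat.beq (Nat.lor (dropBit G) (Nat.pow 2 (lowIndex G))) G)) true (Nat.beq G 0)) 60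

/-- `f u k` holds for each bit `2048 * u + k` of `G`, for `d` with `G < 2 ^ (2048 * 2 ^ d)`. The
halves of `G` are treated separately. -/
def bitsTree (f : ℕ → ℕ → Bool) (d : ℕ) : ℕ → ℕ → Bool :=
  Nat.rec (bitsAll f) (fun d ih u G => Bool.rec (Bool.rec false
      (ih (Nat.succ (Nat.mul 2 u)) (Nat.shiftRight G (Nat.mul 2048 (Nat.pow 2 d))))
      (ih (Nat.mul 2 u) (Nat.mod G (Nat.pow 2 (Nat.mul 2048 (Nat.pow 2 d))))))
    true (Nat.beq G 0)) d

/-! ### Individual treatment -/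

/-- A number fails to divide the least common multiple of `1, …, T` exactly when it has a prime
power divisor greater than `T`. -/
def lcmUpTo (T : ℕ) : ℕ :=
  Nat.rec 1 (fun k ih => Nat.mul ih (Nat.div (Nat.succ k) (Nat.gcd ih (Nat.succ k)))) T

def notDvd (T n : ℕ) : Bool := Nat.ble 1 (Nat.mod (lcmUpTo T) n)

/-- Lucas' criterion for the divisibility of `n.choose k` by the prime `p`. -/
def lucas (p : ℕ) : ℕ → ℕ → Bool :=
  Nat.rec (fun _ _ => false) (fun _ ih n k => either (Nat.ble (Nat.succ (Nat.mod n p)) (Nat.mod k p))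
    (ih (Nat.div n p) (Nat.div k p))) 30

/-- Since `s < q`, for each `i` at most one `t ≤ s` makes `i * ℓ + t` divisible by `q`, namely the
residue of `-i * ℓ`. -/
def target (n ℓ p q s i : ℕ) : Bool :=
  force (fun t => either (Nat.ble (Nat.succ s) t)
      (force (fun k => either (Nat.beq k n) (lucas p n k)) (Nat.add (Nat.mul i ℓ) t)))
    (Nat.mod (Nat.sub q (Nat.mod (Nat.mul i ℓ) q)) q)

def blockOK (n ℓ p s k : ℕ) : Bool :=
  either (either (Nat.ble 1 (Nat.mod n k)) (Nat.ble 1 (Nat.mod k p)))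
    (Nat.ble (Nat.succ s) (Nat.mod (Nat.div n k) ℓ))

def inRange (n c s ℓ : ℕ) : Bool :=
  both (both (Nat.beq n (Nat.add (Nat.mul c ℓ) s)) (both (Nat.ble 1 c) (Nat.ble (Nat.succ c) ℓ)))
    (both (Nat.ble (Nat.succ s) ℓ) (both (Nat.ble 3 ℓ) (Nat.ble (Nat.add ℓ 3) n)))

def witness (n c s ℓ p q : ℕ) : Bool :=
  both (Nat.ble (Nat.succ s) q) (both (upTo (target n ℓ p q s) c)
    (both (upTo (blockOK n ℓ p s) c) (inRange n c s ℓ)))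

def primesOf (ps : List ℕ) (n : ℕ) : List ℕ :=
  foldOf (fun p acc => Bool.rec acc (p :: acc) (Nat.beq (Nat.mod n p) 0)) [] ps

/-- The exponent 30 exhausts the `p`-part of any `n < 2 ^ 30`. -/
def primePart (n p : ℕ) : ℕ := Nat.gcd (Nat.pow p 30) n

def anyWitness (ps : List ℕ) (n c ℓ s : ℕ) : Bool :=
  anyOf (fun p => witness n c s ℓ p (primePart n p)) (primesOf ps n)

def tryPrime (ps : List ℕ) (n c : ℕ) (ih : ℕ → Bool) (ℓ : ℕ) : Bool :=
  either (force (anyWitness ps n c ℓ) (Nat.sub n (Nat.mul c ℓ))) (ih (Nat.sub ℓ 1))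

def hardAt (isP : ℕ → Bool) (ps : List ℕ) (n c : ℕ) : ℕ → ℕ → Bool :=
  Nat.rec (fun _ => false)
    (fun _ ih ℓ => Bool.rec (ih (Nat.sub ℓ 1)) (tryPrime ps n c ih ℓ) (isP ℓ))

/-- There are `c`, `c₀ ≤ c < c₀ + 29`, a prime `ℓ` with `n - S ≤ c * ℓ ≤ n` and a prime from `ps`
that give a witness for `n`. -/
def hardWith (isP : ℕ → Bool) (ps : List ℕ) (S c₀ n : ℕ) : Bool :=
  Nat.rec false (fun k ih => either ih (hardAt isP ps n (Nat.add k c₀)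
    (Nat.succ (Nat.div S (Nat.add k c₀))) (Nat.div n (Nat.add k c₀)))) 29

def firstPrimes : List ℕ := [2, 3, 5, 7, 11, 13, 17, 19, 23, 29, 31, 37, 41, 43, 47, 53, 59, 61, 67,
  71, 73]

def tablePrimes : List ℕ := List.append firstPrimes [79, 83, 89, 97, 101, 103, 107, 109, 113, 127,
  131, 137, 139, 149, 151, 157, 163, 167, 173, 179, 181, 191, 193, 197, 199, 211, 223, 227, 229,
  233, 239, 241, 251, 257, 263, 269, 271, 277, 281, 283, 293, 307, 311, 313, 317, 331, 337, 347,
  349, 353, 359]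

def hardFull (n : ℕ) : Bool := hardWith primeTest tablePrimes 360 1 n

def isNear (n T x : ℕ) : Bool :=
  both (Nat.ble n (Nat.add x T)) (both (Nat.ble (Nat.add x 3) n) (Nat.ble (Nat.succ n) (Nat.mul 2 x)))

def primeBelow (isP : ℕ → Bool) (n T : ℕ) : ℕ → ℕ → Bool :=
  Nat.rec (fun _ => false) (fun _ ih x => Bool.rec (ih (Nat.sub x 2)) (isNear n T x) (isP x))

/-- For `e = (δ, T)`, the number `n` has a prime power divisor greater than `T`, and there is a prime
from `n - T` to `n - δ`. -/
def slowAt (isP : ℕ → Bool) (n : ℕ) (e : ℕ × ℕ) : Bool :=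
  both (notDvd e.2 n) (primeBelow isP n e.2 (Nat.div (Nat.sub e.2 e.1) 2)
    (Nat.succ (Nat.mul 2 (Nat.div (Nat.sub (Nat.sub n e.1) 1) 2))))

def slow (n : ℕ) : Bool :=
  either (anyOf (slowAt rough n)
      [(76, 100), (101, 130), (131, 170), (171, 220), (221, 300), (301, 360)])
    (either (hardWith rough tablePrimes 100 2 n) (hardFull n))

def smallOK (n : ℕ) : Bool :=
  either (anyOf (slowAt primeTest n) [(3, 20), (3, 50), (3, 100)]) (hardFull n)

/-! ### Windows -/

def popIndex (i ρ u k : ℕ) : ℕ :=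
  Nat.add ρ (Nat.mul 30 (Nat.add i (Nat.add k (Nat.add 11 (Nat.mul 2048 u)))))

/-- If `n` does not divide `lcmUpTo 360`, it has a prime power divisor greater than 360, and `noGap`
already supplies a prime close enough. Only the other `n` need `slow`. -/
def popAt (i ρ u k : ℕ) : Bool :=
  Bool.rec (force slow (popIndex i ρ u k)) true
    (Nat.ble 1 (Nat.mod (lcmUpTo 360) (popIndex i ρ u k)))

def residueOK (L i ρ : ℕ) : Bool := bitsTree (popAt i ρ) 9 0 (exceptions L i ρ)

def residues : List ℕ := [0, 1, 2, 3, 4, 5, 6, 7, 8, 9, 10, 11, 12, 13, 14, 15, 16, 17, 18, 19, 20,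
  21, 22, 23, 24, 25, 26, 27, 28, 29]

def windowOK (L i : ℕ) : Bool := both (noGap L i) (allOf (residueOK L i) residues)

/-! ### Numbers without large prime power divisors -/

/-- The list with index `r` serves `n ≡ r` modulo 6 and contains the `d` from 3 to 72 with `n - d`
prime to 6. Multiples of 7 and then of 5 come last: a smooth `n` often shares these factors, and
then `n - d` is not prime. -/
def distances0 : List ℕ := [71, 67, 61, 59, 53, 47, 43, 41, 37, 31, 29, 23, 19, 17, 13, 11, 7, 49,
  5, 25, 65, 55, 35]
def distances1 : List ℕ := [6, 8, 12, 18, 24, 32, 36, 48, 54, 72, 62, 38, 68, 26, 44, 66, 14, 42,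
  56, 20, 30, 50, 60]
def distances2 : List ℕ := [3, 9, 27, 67, 61, 43, 37, 31, 69, 19, 57, 51, 13, 39, 33, 7, 21, 49, 63,
  15, 25, 45, 55]
def distances3 : List ℕ := [4, 8, 16, 32, 64, 62, 58, 46, 38, 34, 68, 26, 52, 22, 44, 14, 28, 56,
  10, 20, 40, 50, 70]
def distances4 : List ℕ := [3, 9, 27, 71, 59, 53, 47, 41, 29, 23, 69, 57, 17, 51, 39, 11, 33, 21,
  63, 5, 15, 45, 65, 35]
def distances5 : List ℕ := [4, 6, 12, 16, 18, 24, 36, 48, 54, 64, 72, 58, 46, 34, 52, 22, 66, 28,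
  42, 10, 30, 40, 60, 70]

def distances (r : ℕ) : List ℕ :=
  Bool.rec (Bool.rec (Bool.rec distances5 distances4 (Nat.beq r 4)) distances3 (Nat.beq r 3))
   (Bool.rec (Bool.rec distances2 distances1 (Nat.beq r 1)) distances0 (Nat.beq r 0)) (Nat.ble r 2)

def nearPrime (n q : ℕ) (l : List ℕ) : Bool :=
  List.rec false (fun d _ ih => Bool.rec ih (Bool.rec true ih (Nat.ble q d))
    (Nat.beq (Nat.gcd (Nat.mod primeProd (Nat.sub n d)) (Nat.sub n d)) 1)) l

/-- Numbers up to 4095 are covered by a separate check. Up to 31999 `n - d` may lie in the range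
where `rough` rejects primes, hence `smallOK`. -/
def leafOK (n q : ℕ) : Bool :=
  Bool.rec (Bool.rec
    (force (fun n => Bool.rec (either (hardWith primeTest firstPrimes 72 2 n) (hardFull n))
      (smallOK n) (Nat.ble n 31999)) n)
    true (Nat.ble n 4095)) true (nearPrime n q (distances (Nat.mod n 6)))

def maxNat (a b : ℕ) : ℕ := Bool.rec a b (Nat.ble a b)

/-- Checks `leafOK` at the multiples `m * k ≤ 10 ^ 9` of `m` for which each row contributes at most
one factor to `k`; the second argument is the greatest of these factors. -/
def enum (rows : List (List ℕ)) : ℕ → ℕ → Bool :=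
  List.rec (motive := fun _ => ℕ → ℕ → Bool) leafOK
    (fun r _ ih m q => Bool.rec false (List.rec true (fun e _ next => Bool.rec true
      (Bool.rec false next (ih (Nat.mul m e) (maxNat q e)))
      (Nat.ble (Nat.mul m e) 1000000000)) r) (ih m q)) rows

def powerRows : List (List ℕ) := [[73], [71], [67], [61], [59], [53], [47], [43], [41], [37], [31],
  [29], [23], [19], [17], [13], [11], [7, 49], [5, 25], [3, 9, 27], [2, 4, 8, 16, 32, 64]]

end

/-! ### Logical meaning of the recursor-based combinators -/

section Recursors

theorem both_iff {a b : Bool} : both a b = true ↔ a = true ∧ b = true := by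
  cases a <;> simp [both]

theorem either_iff {a b : Bool} : either a b = true ↔ a = true ∨ b = true := by
  cases a <;> simp [either]

theorem rec_false_iff {a b : Bool} :
    (Bool.rec false b a : Bool) = true ↔ a = true ∧ b = true := both_iff

theorem rec_true_iff {a b : Bool} :
    (Bool.rec b true a : Bool) = true ↔ a = true ∨ b = true := either_iff

theorem allOf_iff {α : Type} {f : α → Bool} {l : List α} :
    allOf f l = true ↔ ∀ a ∈ l, f a = true := by
  induction l with
  | nil => simp [allOf]
  | cons a l ih =>
    have : allOf f (a :: l) = both (f a) (allOf f l) := rfl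
    rw [this, both_iff, ih, List.forall_mem_cons]

theorem anyOf_iff {α : Type} {f : α → Bool} {l : List α} :
    anyOf f l = true ↔ ∃ a ∈ l, f a = true := by
  induction l with
  | nil => simp [anyOf]
  | cons a l ih =>
    have : anyOf f (a :: l) = either (f a) (anyOf f l) := rfl
    rw [this, either_iff, ih, List.exists_mem_cons_iff]

theorem force_eq {α : Type} (f : ℕ → α) (x : ℕ) : force f x = f x := rfl

theorem upTo_iff {f : ℕ → Bool} {c : ℕ} :
    upTo f c = true ↔ ∀ k, 1 ≤ k → k ≤ c → f k = true := by
  induction c with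
  | zero =>
    refine ⟨fun _ k h1 h2 => by omega, fun _ => rfl⟩
  | succ c ih =>
    have : upTo f (c + 1) = both (f (c + 1)) (upTo f c) := rfl
    rw [this, both_iff, ih]
    constructor
    · rintro ⟨h1, h2⟩ k hk1 hk2
      rcases Nat.lt_or_ge c k with h | h
      · rwa [show k = c + 1 by omega]
      · exact h2 k hk1 h
    · exact fun h => ⟨h _ (by omega) le_rfl, fun k h1 h2 => h k h1 (by omega)⟩

theorem apply_of_allDyadic {f : ℕ → Bool} {d j : ℕ} (h : allDyadic f d j = true) {x : ℕ}
    (hx1 : 2 ^ d * j ≤ x) (hx2 : x < 2 ^ d * (j + 1)) : f x = true := by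
  induction d generalizing j with
  | zero =>
    rw [pow_zero, one_mul] at hx1 hx2
    rw [show x = j by omega]
    exact h
  | succ d ih =>
    obtain ⟨h1, h2⟩ := both_iff.mp
      (show both (allDyadic f d (2 * j)) (allDyadic f d (2 * j + 1)) = true from h)
    rw [pow_succ, mul_assoc] at hx1 hx2
    rcases Nat.lt_or_ge x (2 ^ d * (2 * j + 1)) with h | h
    · exact ih h1 hx1 h
    · refine ih h2 h (lt_of_lt_of_eq hx2 (by ring))

theorem mod_raw (a b : ℕ) : Nat.mod a b = a % b := rfl
theorem div_raw (a b : ℕ) : Nat.div a b = a / b := rfl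
theorem mul_raw (a b : ℕ) : Nat.mul a b = a * b := rfl
theorem add_raw (a b : ℕ) : Nat.add a b = a + b := rfl
theorem sub_raw (a b : ℕ) : Nat.sub a b = a - b := rfl
theorem pow_raw (a b : ℕ) : Nat.pow a b = a ^ b := rfl
theorem lor_raw (a b : ℕ) : Nat.lor a b = a ||| b := rfl
theorem land_raw (a b : ℕ) : Nat.land a b = a &&& b := rfl
theorem shiftLeft_raw (a b : ℕ) : Nat.shiftLeft a b = a <<< b := rfl
theorem shiftRight_raw (a b : ℕ) : Nat.shiftRight a b = a >>> b := rfl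

end Recursors

/-! ### Correctness of the prime table and of the primality tests -/

section Primality

theorem prime_of_mem_smallPrimes : ∀ p ∈ smallPrimes, p.Prime := by
  simp only [smallPrimes, List.forall_mem_cons]
  norm_num

theorem mem_smallPrimes : ∀ p < 179, p.Prime → p ∈ smallPrimes := by
  intro p hp hpp
  unfold smallPrimes
  interval_cases p <;> first | simp; done | (exfalso; revert hpp; norm_num)

theorem dvd_foldOf_mul {l : List ℕ} {p : ℕ} (hp : p ∈ l) : p ∣ foldOf Nat.mul 1 l := by
  induction l with
  | nil => simp at hp
  | cons a l ih =>
    have h1 : foldOf Nat.mul 1 (a :: l) = a * foldOf Nat.mul 1 l := rfl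
    rw [h1]
    rcases List.mem_cons.mp hp with rfl | h
    · exact Dvd.intro _ rfl
    · exact (ih h).mul_left _

theorem exists_mem_dvd_of_dvd_foldOf_mul {l : List ℕ} {p : ℕ} (hp : p.Prime)
    (h : p ∣ foldOf Nat.mul 1 l) : ∃ a ∈ l, p ∣ a := by
  induction l with
  | nil => exact absurd (Nat.dvd_one.mp h) hp.one_lt.ne'
  | cons a l ih =>
    have h1 : foldOf Nat.mul 1 (a :: l) = a * foldOf Nat.mul 1 l := rfl
    rw [h1] at h
    rcases hp.dvd_mul.mp h with h | h
    · exact ⟨a, List.mem_cons_self, h⟩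
    · obtain ⟨b, hb, hpb⟩ := ih h
      exact ⟨b, List.mem_cons_of_mem _ hb, hpb⟩

theorem exists_mem_dvd_of_dvd_primeProd {p : ℕ} (hp : p.Prime) (h : p ∣ primeProd) :
    p ∣ 30 ∨ ∃ r ∈ primeRows, ∃ a ∈ r, p ∣ a := by
  unfold primeProd at h
  rcases hp.dvd_mul.mp h with h | h
  · exact Or.inl h
  right
  generalize primeRows = rows at h ⊢
  induction rows with
  | nil => exact absurd (Nat.dvd_one.mp h) hp.one_lt.ne'
  | cons r rows ih =>
    rcases hp.dvd_mul.mp h with h | h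
    · exact ⟨r, List.mem_cons_self, exists_mem_dvd_of_dvd_foldOf_mul hp h⟩
    · obtain ⟨s, hs, hps⟩ := ih h
      exact ⟨s, List.mem_cons_of_mem _ hs, hps⟩

theorem prime_of_smallPrimeTest {x : ℕ} (hx : x < 32041) (h : smallPrimeTest x = true) :
    x.Prime := by
  unfold smallPrimeTest at h
  cases hb : Nat.ble x 178 with
  | false =>
    rw [hb] at h
    have h1 : 178 < x := by
      by_contra h1
      rw [Nat.ble_eq_true_of_le (by omega)] at hb
      exact Bool.false_ne_true hb.symm
    have h2 := Nat.eq_of_beq_eq_true h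
    by_contra hx'
    have h3 : x.minFac ^ 2 ≤ x := Nat.minFac_sq_le_self (by omega) hx'
    have h4 : x.minFac.Prime := Nat.minFac_prime (by omega)
    have h5 : x.minFac ∈ smallPrimes := mem_smallPrimes _ (by nlinarith) h4
    have h6 := Nat.dvd_gcd (dvd_foldOf_mul h5) x.minFac_dvd
    rw [h2] at h6
    exact h4.one_lt.ne' (Nat.dvd_one.mp h6)
  | true =>
    rw [hb] at h
    obtain ⟨p, hp, hpx⟩ := anyOf_iff.mp h
    rw [Nat.eq_of_beq_eq_true hpx]
    exact prime_of_mem_smallPrimes p hp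

/-- The first entry must be the least, because the sieve skips a row on the strength of its first
entry alone. The bound 32040 is the range of `smallPrimeTest`. -/
def rowValid (r : List ℕ) : Bool :=
  allOf (fun e => both (both (Nat.ble (List.headD r 0) e) (Nat.ble e 32040))
    (both (smallPrimeTest e) (Nat.beq (Nat.mod (Nat.succ (Nat.mul 30 (negInv e))) e) 0))) r

theorem allOf_rowValid : allOf rowValid primeRows = true := by decide +kernel

theorem of_mem_primeRows {r : List ℕ} (hr : r ∈ primeRows) {e : ℕ} (he : e ∈ r) :
    r.headD 0 ≤ e ∧ e.Prime ∧ e ∣ 30 * negInv e + 1 := by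
  have h := allOf_iff.mp (allOf_iff.mp allOf_rowValid r hr) e he
  simp only [both_iff] at h
  have h2 := Nat.le_of_ble_eq_true h.1.2
  exact ⟨Nat.le_of_ble_eq_true h.1.1, prime_of_smallPrimeTest (by omega) h.2.1,
    Nat.dvd_of_mod_eq_zero (Nat.eq_of_beq_eq_true h.2.2)⟩

/-- Completeness of the table without a list of the omitted numbers: each `x` from 2 to 31627 shares
a factor with `primeProd`, and for a prime `x` that factor is `x`. -/
theorem not_rough_of_lt :
    allDyadic (fun x => either (either (Nat.ble x 1) (Nat.ble 31628 x))
      (Nat.ble 2 (Nat.gcd (Nat.mod primeProd x) x))) 15 0 = true := by decide +kernel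

theorem dvd_primeProd {p : ℕ} (hp : p.Prime) (hlt : p < 31628) : p ∣ primeProd := by
  have h := apply_of_allDyadic not_rough_of_lt (x := p) (by norm_num) (by norm_num; omega)
  rw [either_iff, either_iff] at h
  rcases h with (h | h) | h
  · have := Nat.le_of_ble_eq_true h
    have := hp.one_lt
    omega
  · have := Nat.le_of_ble_eq_true h
    omega
  · have h := Nat.le_of_ble_eq_true h
    rw [mod_raw] at h
    rcases hp.eq_one_or_self_of_dvd _ (Nat.gcd_dvd_right (primeProd % p) p) with h' | h'
    · omega
    · have h2 := Nat.gcd_dvd_left (primeProd % p) p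
      rw [h'] at h2
      exact (Nat.dvd_mod_iff dvd_rfl).mp h2

/-- The bound is `31628 ^ 2`, so a composite `x` has a prime factor dividing `primeProd`. -/
theorem prime_of_rough {x : ℕ} (h1 : 1 < x) (hx : x < 1000330384) (h : rough x = true) :
    x.Prime := by
  by_contra hx'
  have h3 : x.minFac ^ 2 ≤ x := Nat.minFac_sq_le_self (by omega) hx'
  have h4 : x.minFac.Prime := Nat.minFac_prime (by omega)
  have h5 := dvd_primeProd h4 (by nlinarith)
  have h6 := Nat.eq_of_beq_eq_true h
  rw [mod_raw] at h6
  have h7 := Nat.dvd_gcd ((Nat.dvd_mod_iff x.minFac_dvd).mpr h5) x.minFac_dvd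
  rw [h6] at h7
  exact h4.one_lt.ne' (Nat.dvd_one.mp h7)

theorem prime_of_primeTest {x : ℕ} (h1 : 1 < x) (hx : x < 1000330384) (h : primeTest x = true) :
    x.Prime := by
  unfold primeTest at h
  cases hb : Nat.ble x 31627 with
  | false => rw [hb] at h; exact prime_of_rough h1 hx h
  | true =>
    rw [hb] at h
    have := Nat.le_of_ble_eq_true hb
    exact prime_of_smallPrimeTest (by omega) h

theorem exists_mem_primeRows {p : ℕ} (hp : p.Prime) (h5 : 5 < p) (hlt : p < 31628) :
    ∃ r ∈ primeRows, p ∈ r := by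
  rcases exists_mem_dvd_of_dvd_primeProd hp (dvd_primeProd hp hlt) with h | ⟨r, hr, a, ha, h⟩
  · have h1 : p ∈ Nat.primeFactors 30 := Nat.mem_primeFactors.mpr ⟨hp, h, by norm_num⟩
    have h2 : p ≤ 30 := Nat.le_of_dvd (by norm_num) h
    interval_cases p <;> first | omega | (revert hp; norm_num)
  · refine ⟨r, hr, ?_⟩
    rwa [(Nat.prime_dvd_prime_iff_eq hp (of_mem_primeRows hr ha).2.1).mp h]

end Primality

/-! ### Correctness of the sieve on bits -/

section Sieve

theorem testBit_progression {p fuel J j : ℕ} (hJ : J ≤ 2 ^ fuel) (hj : j < J) :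
    (progression p fuel J).testBit (p * j) = true := by
  induction fuel generalizing J j with
  | zero =>
    obtain rfl : j = 0 := by simp at hJ; omega
    simp [progression]
  | succ fuel ih =>
    have h : progression p (fuel + 1) J = (Bool.rec
      ((progression p fuel ((J + 1) / 2)) |||
        ((progression p fuel ((J + 1) / 2)) <<< (p * (J / 2)))) 1 (Nat.ble J 1) : ℕ) := rfl
    rw [h]
    cases hb : Nat.ble J 1 with
    | true =>
      have := Nat.le_of_ble_eq_true hb
      obtain rfl : j = 0 := by omega
      simp
    | false =>
      have hJ' : (J + 1) / 2 ≤ 2 ^ fuel := by rw [pow_succ] at hJ; omega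
      simp only [Nat.testBit_or, Bool.or_eq_true]
      -- Two copies of the first half, the second shifted by `J / 2` terms, cover the progression;
      -- they overlap when `J` is odd.
      rcases Nat.lt_or_ge j ((J + 1) / 2) with h | h
      · exact Or.inl (ih hJ' h)
      · right
        rw [Nat.testBit_shiftLeft, Bool.and_eq_true, decide_eq_true_iff, ← Nat.mul_sub]
        exact ⟨Nat.mul_le_mul_left _ (by omega), ih hJ' (by omega)⟩

theorem testBit_multiples {L p t : ℕ} (hL : L < 2 ^ 31) (hp : 0 < p) (ht : t ≤ L) (hpt : p ∣ t) :
    (multiples L p).testBit t = true := by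
  obtain ⟨j, rfl⟩ := hpt
  refine testBit_progression ?_ (Nat.lt_succ_of_le ((Nat.le_div_iff_mul_le hp).mpr ?_))
  · have : L / p ≤ L := Nat.div_le_self _ _
    rw [div_raw]
    norm_num at hL ⊢
    omega
  · rwa [mul_comm]

theorem testBit_shiftLeft_multiples {L p o j : ℕ} (hL : L < 2 ^ 31) (hp : 0 < p) (hj : j < L)
    (h : j ≡ o [MOD p]) : (Nat.shiftLeft (multiples L p) (Nat.mod o p)).testBit j = true := by
  have h' : o % p = j % p := h.symm
  rw [shiftLeft_raw, mod_raw, h', Nat.testBit_shiftLeft, Bool.and_eq_true, decide_eq_true_iff]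
  exact ⟨Nat.mod_le _ _, testBit_multiples hL hp (by omega) (Nat.dvd_sub_mod j)⟩

/-- `v` is the inverse of `-c`, so the congruence solves to `i + j ≡ v * b`; the term `(m - 1) * i`
stands for `-i`. -/
theorem modEq_of_dvd {i j c v b m : ℕ} (hm : 0 < m) (hv : m ∣ c * v + 1)
    (h : m ∣ c * (i + j) + b) : j ≡ v * b + (m - 1) * i [MOD m] := by
  rw [Nat.modEq_iff_dvd]
  have hv' : (m : ℤ) ∣ c * v + 1 := by exact_mod_cast hv
  have h' : (m : ℤ) ∣ c * (i + j) + b := by exact_mod_cast h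
  push_cast [Nat.cast_sub (show 1 ≤ m from hm)]
  have : (v * b + (m - 1) * i - j : ℤ) =
      v * (c * (i + j) + b) + m * i - (i + j) * (c * v + 1) := by ring
  rw [this]
  exact dvd_sub (dvd_add (h'.mul_left _) (dvd_mul_right _ _)) (hv'.mul_left _)

theorem testBit_rowComposites {L i a j p : ℕ} {r : List ℕ} (hL : L < 2 ^ 31) (hj : j < L)
    (hr : ∀ e ∈ r, e.Prime ∧ e ∣ 30 * negInv e + 1) (hpr : p ∈ r) (hp : p ∣ 30 * (i + j) + a) :
    (rowComposites L i a r).testBit j = true := by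
  induction r with
  | nil => simp at hpr
  | cons e r ih =>
    have h : rowComposites L i a (e :: r) = Nat.shiftLeft (multiples L e)
        (Nat.mod (a * negInv e + (e - 1) * i) e) ||| rowComposites L i a r := rfl
    rw [h, Nat.testBit_or, Bool.or_eq_true]
    rcases List.mem_cons.mp hpr with rfl | hpr
    · left
      obtain ⟨h1, h2⟩ := hr p List.mem_cons_self
      apply testBit_shiftLeft_multiples hL h1.pos hj
      rw [mul_comm a]
      exact modEq_of_dvd h1.pos h2 hp
    · exact Or.inr (ih (fun e he => hr e (List.mem_cons_of_mem _ he)) hpr)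

theorem testBit_composites {L i a j p : ℕ} (hL : L < 2 ^ 31) (hj : j < L) (hp : p.Prime)
    (h5 : 5 < p) (hlt : p < 31628) (hp2 : p * p ≤ 30 * (i + L)) (hpx : p ∣ 30 * (i + j) + a) :
    (composites L i a).testBit j = true := by
  obtain ⟨r, hr, hpr⟩ := exists_mem_primeRows hp h5 hlt
  unfold composites
  have hrows : ∀ r ∈ primeRows, ∀ e ∈ r, r.headD 0 ≤ e ∧ e.Prime ∧ e ∣ 30 * negInv e + 1 :=
    fun r hr e he => of_mem_primeRows hr he
  generalize primeRows = rows at hr hrows ⊢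
  induction rows with
  | nil => simp at hr
  | cons s rows ih =>
    change (Bool.rec (List.rec 0 (fun r _ ih => Bool.rec ih (Nat.lor (rowComposites L i a r) ih)
      (Nat.ble (Nat.mul (List.headD r 0) (List.headD r 0)) (Nat.mul 30 (Nat.add i L)))) rows)
      (rowComposites L i a s ||| (List.rec 0 (fun r _ ih => Bool.rec ih
        (Nat.lor (rowComposites L i a r) ih)
        (Nat.ble (Nat.mul (List.headD r 0) (List.headD r 0)) (Nat.mul 30 (Nat.add i L)))) rows))
      (Nat.ble (s.headD 0 * s.headD 0) (30 * (i + L))) : ℕ).testBit j = true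
    rcases List.mem_cons.mp hr with rfl | hr
    · have h1 := hrows r List.mem_cons_self
      have h2 : Nat.ble (r.headD 0 * r.headD 0) (30 * (i + L)) = true :=
        Nat.ble_eq_true_of_le ((Nat.mul_le_mul (h1 p hpr).1 (h1 p hpr).1).trans hp2)
      rw [h2]
      simp only [Nat.testBit_or, Bool.or_eq_true]
      exact Or.inl (testBit_rowComposites hL hj (fun e he => (h1 e he).2) hpr hpx)
    · have h1 := ih hr (fun r hr => hrows r (List.mem_cons_of_mem _ hr))
      cases Nat.ble (s.headD 0 * s.headD 0) (30 * (i + L)) with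
      | false => exact h1
      | true =>
        simp only [Nat.testBit_or, Bool.or_eq_true]
        exact Or.inr h1

/-- The least prime factor of a composite value exceeds 5 as `a` is prime to 30, and its square is
small enough for its row to be sieved. -/
theorem prime_of_testBit_composites_eq_false {L i a j : ℕ} (hL : L < 2 ^ 31)
    (hiL : 30 * (i + L) ≤ 1000330384) (hj : j < L) (ha : a < 30) (hcop : Nat.gcd a 30 = 1)
    (h1 : 1 < 30 * (i + j) + a) (h : (composites L i a).testBit j = false) :
    (30 * (i + j) + a).Prime := by
  by_contra hx
  set x := 30 * (i + j) + a with hxdef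
  have h3 : x.minFac ^ 2 ≤ x := Nat.minFac_sq_le_self (by omega) hx
  have h4 : x.minFac.Prime := Nat.minFac_prime (by omega)
  have h5 : 5 < x.minFac := by
    by_contra h5
    have h6 : x.minFac ∣ 30 := by
      have : x.minFac ≤ 5 := by omega
      have := h4.two_le
      generalize x.minFac = m at *
      interval_cases m <;> first | norm_num; done | (exfalso; revert h4; norm_num)
    have h7 : x.minFac ∣ a := (Nat.dvd_add_right (h6.mul_right _)).mp (hxdef ▸ x.minFac_dvd)
    have h8 := Nat.dvd_gcd h7 h6
    rw [hcop] at h8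
    exact h4.one_lt.ne' (Nat.dvd_one.mp h8)
  have h9 : x < 30 * (i + L) := by omega
  have := testBit_composites (a := a) hL hj h4 h5 (by nlinarith) (by nlinarith) x.minFac_dvd
  rw [h] at this
  exact Bool.false_ne_true this

theorem testBit_divides {L i ρ j m g v : ℕ} (hL : L < 2 ^ 31) (hm : 0 < m) (hj : j < L)
    (hg : g ∣ 30) (hv : m ∣ 30 / g * v + 1) (h : g * m ∣ 30 * (i + j) + ρ) :
    (divides L i ρ (m, g, v)).testBit j = true := by
  obtain ⟨c, hc⟩ := hg
  have hg0 : 0 < g := Nat.pos_of_ne_zero fun h0 => by simp [h0] at hc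
  have hgρ : g ∣ ρ := by
    have h1 : g ∣ 30 * (i + j) + ρ := (Nat.dvd_mul_right _ _).trans h
    exact (Nat.dvd_add_right ((Dvd.intro c hc.symm).mul_right _)).mp h1
  obtain ⟨b, rfl⟩ := hgρ
  have h1 : divides L i (g * b) (m, g, v) = (Bool.rec 0 (Nat.shiftLeft (multiples L m)
    (Nat.mod (v * (g * b / g) + (m - 1) * i) m)) (Nat.beq (g * b % g) 0) : ℕ) := rfl
  rw [h1, Nat.mul_mod_right, Nat.mul_div_cancel_left _ hg0]
  apply testBit_shiftLeft_multiples hL hm hj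
  rw [hc, Nat.mul_div_cancel_left _ hg0] at hv
  apply modEq_of_dvd hm hv
  rw [hc, mul_assoc, ← Nat.mul_add] at h
  exact Nat.dvd_of_mul_dvd_mul_left hg0 h

theorem testBit_addDivisors_eq_false {L i ρ X j : ℕ} {l : List (ℕ × ℕ × ℕ)}
    (h : (addDivisors L i ρ X l).testBit j = false) :
    X.testBit j = false ∧ ∀ e ∈ l, (divides L i ρ e).testBit j = false := by
  induction l with
  | nil => exact ⟨h, by simp⟩
  | cons e l ih =>
    have h1 : addDivisors L i ρ X (e :: l) = divides L i ρ e ||| addDivisors L i ρ X l := rfl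
    rw [h1, Nat.testBit_or, Bool.or_eq_false_iff] at h
    obtain ⟨h2, h3⟩ := ih h.2
    exact ⟨h2, List.forall_mem_cons.mpr ⟨h.1, h3⟩⟩

def EntryValid (e : ℕ × ℕ × ℕ) : Prop := 0 < e.1 ∧ e.2.1 ∣ 30 ∧ e.1 ∣ 30 / e.2.1 * e.2.2 + 1

instance (e : ℕ × ℕ × ℕ) : Decidable (EntryValid e) := by unfold EntryValid; infer_instance

/-- Each row consumed lowers `d` by one, that is, moves the candidate prime one step further from
`n`. A clear bit means that the candidate at some depth `k` survived the sieve while no prime power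
from the earlier rows divides `n`. The bound `d < 330` keeps the shift `10 - d / 30` exact. -/
theorem exists_of_testBit_exceptFrom_eq_false {L i ρ j d : ℕ} {t : List (List (ℕ × ℕ × ℕ))}
    (hL : L < 2 ^ 31) (hiL : 30 * (i + L) ≤ 1000330384) (hi : 0 < i) (hj : 10 ≤ j) (hjL : j < L)
    (hd : d < 330) (hdt : t.length ≤ d) (ht : ∀ l ∈ t, ∀ e ∈ l, EntryValid e)
    (h : (exceptFrom L i ρ t d).testBit j = false) :
    ∃ k, k < t.length ∧ (30 * (i + j - 10) + d - k).Prime ∧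
      ∀ k' < k, ∀ e ∈ t.getD k' [], ¬ e.2.1 * e.1 ∣ 30 * (i + j) + ρ := by
  induction t generalizing d with
  | nil =>
    have h1 : exceptFrom L i ρ [] d = 2 ^ L - 1 := rfl
    rw [h1, Nat.testBit_two_pow_sub_one] at h
    simp [hjL] at h
  | cons l t ih =>
    have hX : (addDivisors L i ρ (exceptFrom L i ρ t (d - 1)) l).testBit j = false →
        ∃ k, k < (l :: t).length ∧ (30 * (i + j - 10) + d - k).Prime ∧
          ∀ k' < k, ∀ e ∈ (l :: t).getD k' [], ¬ e.2.1 * e.1 ∣ 30 * (i + j) + ρ := by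
      intro hX
      obtain ⟨h1, h2⟩ := testBit_addDivisors_eq_false hX
      rw [List.length_cons] at hdt
      obtain ⟨k, hk, hkp, hk'⟩ := ih (d := d - 1) (by omega) (by omega)
        (fun l hl => ht l (List.mem_cons_of_mem _ hl)) h1
      refine ⟨k + 1, by simpa using hk, ?_, ?_⟩
      · rwa [show 30 * (i + j - 10) + d - (k + 1) = 30 * (i + j - 10) + (d - 1) - k by omega]
      · rintro (_ | k') hkk e he
        · intro hdvd
          obtain ⟨h3, h4, h5⟩ := ht l List.mem_cons_self e (by simpa using he)
          have := h2 e (by simpa using he)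
          rw [testBit_divides hL h3 hjL h4 h5 hdvd] at this
          exact Bool.false_ne_true this.symm
        · exact hk' k' (by omega) e (by simpa using he)
    have h1 : exceptFrom L i ρ (l :: t) d =
        (Bool.rec (addDivisors L i ρ (exceptFrom L i ρ t (d - 1)) l)
          ((composites L i (d % 30)) <<< (10 - d / 30) &&&
            (addDivisors L i ρ (exceptFrom L i ρ t (d - 1)) l)) (Nat.beq (Nat.gcd d 30) 1) : ℕ) :=
      rfl
    rw [h1] at h
    cases hb : Nat.beq (Nat.gcd d 30) 1 with
    | false => rw [hb] at h; exact hX h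
    | true =>
      rw [hb] at h
      simp only [Nat.testBit_and, Bool.and_eq_false_iff] at h
      rcases h with h | h
      · refine ⟨0, by simp, ?_, by simp⟩
        rw [Nat.testBit_shiftLeft, Bool.and_eq_false_iff] at h
        rcases h with h | h
        · simp at h; omega
        · have hcop := Nat.eq_of_beq_eq_true hb
          have h2 := prime_of_testBit_composites_eq_false hL hiL (by omega) (Nat.mod_lt _ (by omega))
            (by rw [← Nat.gcd_rec, Nat.gcd_comm]; exact hcop) (by omega) h
          convert h2 using 1
          omega
      · exact hX h

end Sieve

/-! ### Correctness of the window test -/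

section Windows

theorem testBit_exceptions {L i ρ t : ℕ} (ht : t + 11 < L) :
    (exceptions L i ρ).testBit t =
      (exceptFrom L i ρ sieveTable (ρ + 297)).testBit (t + 11) := by
  have h : exceptions L i ρ = (exceptFrom L i ρ sieveTable (ρ + 297) % 2 ^ L) >>> 11 := rfl
  rw [h, Nat.testBit_shiftRight, Nat.testBit_mod_two_pow, add_comm 11, decide_eq_true ht,
    Bool.true_and]

theorem sieveTable_valid : ∀ l ∈ sieveTable, ∀ e ∈ l, EntryValid e := by decide +kernel

theorem length_sieveTable : sieveTable.length = 280 := by decide +kernel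

/-- A decidable form of completeness: a number that is not a prime power splits into coprime
factors, the smaller of which is below 17 since `17 ^ 2 > 283`. -/
theorem exists_coprime_split_or_mem_sieveTable : ∀ q < 284, 79 ≤ q →
    (∃ a < 18, a ∣ q ∧ 1 < a ∧ 1 < q / a ∧ Nat.gcd a (q / a) = 1) ∨
      ∃ e ∈ sieveTable.getD (q - 4) [], e.2.1 * e.1 = q := by
  decide +kernel

theorem not_coprime_split {p a b c : ℕ} (hp : p.Prime) (h : b * c = p ^ a) (hb : 1 < b)
    (hc : 1 < c) : Nat.gcd b c ≠ 1 := by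
  obtain ⟨k, -, rfl⟩ := (Nat.dvd_prime_pow hp).mp (Dvd.intro _ h)
  obtain ⟨l, -, rfl⟩ := (Nat.dvd_prime_pow hp).mp (Dvd.intro_left _ h)
  intro h1
  have hk : k ≠ 0 := by rintro rfl; simp at hb
  have hl : l ≠ 0 := by rintro rfl; simp at hc
  have := Nat.dvd_gcd (dvd_pow_self p hk) (dvd_pow_self p hl)
  rw [h1] at this
  exact hp.one_lt.ne' (Nat.dvd_one.mp this)

theorem exists_mem_sieveTable {p a : ℕ} (hp : p.Prime) (h1 : 79 ≤ p ^ a) (h2 : p ^ a < 284) :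
    ∃ e ∈ sieveTable.getD (p ^ a - 4) [], e.2.1 * e.1 = p ^ a := by
  rcases exists_coprime_split_or_mem_sieveTable _ h2 h1 with ⟨b, -, hb, hb1, hc1, hbc⟩ | h
  · exact absurd hbc (not_coprime_split hp (Nat.mul_div_cancel' hb) hb1 hc1)
  · exact h

/-- `n` is settled by a prime divisor power `q` and a prime at a distance less than `q` below. -/
theorem universallyGenerated_of_sub {n p a δ : ℕ} (hp : p.Prime) (hpn : p ^ a ∣ n)
    (hδ3 : 3 ≤ δ) (hδ : δ < p ^ a) (hδn : 2 * δ < n) (hprime : (n - δ).Prime) :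
    UniversallyGenerated n :=
  universallyGenerated_of_prime hp hprime dvd_rfl hpn (by omega) (by omega) (by omega)

/-- The prime found lies at distance `δ = k + 3`. If `p ^ a ≤ δ`, this power would stand in row `p ^
a - 4 < k`, and the sieve excludes divisors from these rows. -/
theorem universallyGenerated_of_testBit_exceptions_eq_false {L i ρ t n p a : ℕ} (hL : L < 2 ^ 31)
    (hiL : 30 * (i + L) ≤ 1000330384) (hi : 100 ≤ i) (ht : t + 11 < L) (hρ : ρ < 30)
    (hn : n = 30 * (i + (t + 11)) + ρ) (hp : p.Prime) (hpn : p ^ a ∣ n) (hpa : 79 ≤ p ^ a)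
    (h : (exceptions L i ρ).testBit t = false) : UniversallyGenerated n := by
  rw [testBit_exceptions ht] at h
  obtain ⟨k, hk, hkp, hk'⟩ := exists_of_testBit_exceptFrom_eq_false hL hiL (by omega)
    (by omega) ht (by omega) (by rw [length_sieveTable]; omega) sieveTable_valid h
  rw [length_sieveTable] at hk
  refine universallyGenerated_of_sub (δ := k + 3) hp hpn (by omega) ?_ (by omega) ?_
  · by_contra hlt
    obtain ⟨e, he, heq⟩ := exists_mem_sieveTable hp hpa (by omega)
    exact hk' _ (by omega) e he (by rw [heq, ← hn]; exact hpn)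
  · convert hkp using 1
    omega

theorem testBit_dropBit_or {G k : ℕ}
    (h : Nat.beq (Nat.lor (dropBit G) (Nat.pow 2 (lowIndex G))) G = true)
    (hk : G.testBit k = true) : k = lowIndex G ∨ (dropBit G).testBit k = true := by
  have h1 := Nat.eq_of_beq_eq_true h
  rw [← h1, lor_raw, pow_raw, Nat.testBit_or, Bool.or_eq_true, Nat.testBit_two_pow] at hk
  rcases hk with hk | hk
  · exact Or.inr hk
  · exact Or.inl (of_decide_eq_true hk).symm

theorem apply_of_bitsAll {f : ℕ → ℕ → Bool} {u G : ℕ} (h : bitsAll f u G = true) {k : ℕ}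
    (hk : G.testBit k = true) : f u k = true := by
  unfold bitsAll at h
  generalize 60 = fuel at h
  induction fuel generalizing G with
  | zero => exact absurd h Bool.false_ne_true
  | succ fuel ih =>
    rcases rec_true_iff.mp h with h | h
    · rw [Nat.eq_of_beq_eq_true h, Nat.zero_testBit] at hk
      exact absurd hk Bool.false_ne_true
    · obtain ⟨h1, h2⟩ := rec_false_iff.mp h
      obtain ⟨h2, h3⟩ := rec_false_iff.mp h2
      rcases testBit_dropBit_or h1 hk with rfl | hk
      · exact h2
      · exact ih hk h3

theorem exists_of_bitsTree {f : ℕ → ℕ → Bool} {d u G : ℕ} (h : bitsTree f d u G = true) {t : ℕ}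
    (ht : G.testBit t = true) :
    ∃ v k, 2048 * v + k = 2048 * (2 ^ d * u) + t ∧ f v k = true := by
  induction d generalizing u G t with
  | zero => exact ⟨u, t, by rw [pow_zero, one_mul], apply_of_bitsAll h ht⟩
  | succ d ih =>
    rcases rec_true_iff.mp h with h | h
    · rw [Nat.eq_of_beq_eq_true h, Nat.zero_testBit] at ht
      exact absurd ht Bool.false_ne_true
    · obtain ⟨h1, h2⟩ := rec_false_iff.mp h
      rcases Nat.lt_or_ge t (2048 * 2 ^ d) with hlt | hle
      · obtain ⟨v, k, hvk, hf⟩ := ih h1 (t := t) (by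
          rw [mod_raw, pow_raw, pow_raw, mul_raw, Nat.testBit_mod_two_pow, decide_eq_true hlt, ht]
          rfl)
        exact ⟨v, k, by rw [hvk, mul_raw]; ring, hf⟩
      · obtain ⟨v, k, hvk, hf⟩ := ih h2 (t := t - 2048 * 2 ^ d) (by
          rw [shiftRight_raw, pow_raw, mul_raw, Nat.testBit_shiftRight, Nat.add_sub_cancel' hle, ht])
        refine ⟨v, k, ?_, hf⟩
        rw [hvk, mul_raw, Nat.succ_eq_add_one, pow_succ]
        have h3 : 2048 * (2 ^ d * (2 * u + 1)) = 2048 * (2 ^ d * 2 * u) + 2048 * 2 ^ d := by ring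
        omega

theorem testBit_run10_run2 {x j : ℕ} (hj : 9 ≤ j) (h : ∀ k ≤ 9, x.testBit (j - k) = true) :
    (run10 (run2 x)).testBit j = true := by
  have h2 : ∀ k ≤ 8, (run2 x).testBit (j - k) = true := by
    intro k hk
    unfold run2
    rw [land_raw, shiftLeft_raw, Nat.testBit_and, Nat.testBit_shiftLeft, h k (by omega),
      Nat.sub_sub, h (k + 1) (by omega), decide_eq_true (by omega)]
    rfl
  unfold run10
  simp only [land_raw, shiftLeft_raw, Nat.testBit_and, Nat.testBit_shiftLeft]
  rw [h2 2 (by omega), h2 4 (by omega), h2 6 (by omega), h2 8 (by omega),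
    show (run2 x).testBit j = true from h2 0 (by omega), decide_eq_true (by omega),
    decide_eq_true (by omega), decide_eq_true (by omega), decide_eq_true (by omega)]
  rfl

theorem testBit_emptyBlocks_eq_false {L i j : ℕ} (hj : j < L)
    (h : (emptyBlocks L i).testBit j = false) :
    ∃ a < 30, Nat.gcd a 30 = 1 ∧ (composites L i a).testBit j = false := by
  unfold emptyBlocks at h
  have hl : ∀ a ∈ [1, 7, 11, 13, 17, 19, 23, 29], a < 30 ∧ Nat.gcd a 30 = 1 := by decide
  generalize [1, 7, 11, 13, 17, 19, 23, 29] = l at h hl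
  induction l with
  | nil =>
    have h1 : (2 ^ L - 1).testBit j = false := h
    rw [Nat.testBit_two_pow_sub_one, decide_eq_true hj] at h1
    exact absurd h1.symm Bool.false_ne_true
  | cons a l ih =>
    rw [show foldOf (fun a acc => Nat.land (force (composites L i) a) acc)
      (Nat.sub (Nat.pow 2 L) 1) (a :: l) = composites L i a &&&
        foldOf (fun a acc => Nat.land (force (composites L i) a) acc)
          (Nat.sub (Nat.pow 2 L) 1) l from rfl, Nat.testBit_and, Bool.and_eq_false_iff] at h
    rcases h with h | h
    · exact ⟨a, (hl a List.mem_cons_self).1, (hl a List.mem_cons_self).2, h⟩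
    · exact ih h fun b hb => hl b (List.mem_cons_of_mem _ hb)

/-- Otherwise ten consecutive blocks of length 30 contain no prime, and the bit for such a run would
be set. -/
theorem exists_prime_of_noGap {L i j : ℕ} (hL : L < 2 ^ 31) (hiL : 30 * (i + L) ≤ 1000330384)
    (hi : 0 < i) (hj : 9 ≤ j) (hjL : j < L) (h : noGap L i = true) :
    ∃ k ≤ 9, ∃ a < 30, (30 * (i + (j - k)) + a).Prime := by
  have h1 : ((run10 (run2 (emptyBlocks L i)) % 2 ^ L) >>> 9) = 0 := Nat.eq_of_beq_eq_true h
  have h2 : ((run10 (run2 (emptyBlocks L i)) % 2 ^ L) >>> 9).testBit (j - 9) = false := by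
    rw [h1, Nat.zero_testBit]
  rw [Nat.testBit_shiftRight, Nat.add_sub_cancel' hj, Nat.testBit_mod_two_pow, decide_eq_true hjL,
    Bool.true_and] at h2
  by_contra! hcon
  rw [testBit_run10_run2 hj] at h2
  · exact Bool.false_ne_true h2.symm
  intro k hk
  by_contra hb
  obtain ⟨a, ha, hcop, hc⟩ := testBit_emptyBlocks_eq_false (by omega)
    (Bool.eq_false_iff.mpr hb)
  exact hcon k hk a ha
    (prime_of_testBit_composites_eq_false hL hiL (by omega) ha hcop (by omega) hc)

end Windows

/-! ### Correctness of the tests for single numbers -/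

section Individual

theorem dvd_lcmUpTo {T m : ℕ} (hm : 0 < m) (hmT : m ≤ T) : m ∣ lcmUpTo T := by
  induction T with
  | zero => omega
  | succ T ih =>
    have h : lcmUpTo (T + 1) = lcmUpTo T * ((T + 1) / Nat.gcd (lcmUpTo T) (T + 1)) := rfl
    have h1 : lcmUpTo (T + 1) = Nat.lcm (lcmUpTo T) (T + 1) := by
      rw [h, Nat.lcm, Nat.mul_div_assoc _ (Nat.gcd_dvd_right _ _)]
    rw [h1]
    rcases Nat.lt_or_ge T m with h | h
    · rw [show m = T + 1 by omega]
      exact Nat.dvd_lcm_right _ _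
    · exact (ih h).trans (Nat.dvd_lcm_left _ _)

theorem exists_prime_pow_dvd_of_not_dvd_lcmUpTo {T n : ℕ} (h : ¬ n ∣ lcmUpTo T) :
    ∃ p a, p.Prime ∧ p ^ a ∣ n ∧ T < p ^ a := by
  by_contra! hcon
  apply h
  rw [Nat.dvd_iff_prime_pow_dvd_dvd]
  intro p k hp hpk
  exact dvd_lcmUpTo (pow_pos hp.pos _) (hcon p k hp hpk)

theorem exists_prime_pow_dvd_of_mod {T n : ℕ}
    (h : Nat.ble 1 (Nat.mod (lcmUpTo T) n) = true) : ∃ p a, p.Prime ∧ p ^ a ∣ n ∧ T < p ^ a := by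
  apply exists_prime_pow_dvd_of_not_dvd_lcmUpTo
  intro hdvd
  have h := Nat.le_of_ble_eq_true h
  rw [mod_raw, Nat.mod_eq_zero_of_dvd hdvd] at h
  omega

/-- The test `isP` is correct for the numbers in question. -/
def Detects (isP : ℕ → Bool) : Prop :=
  ∀ x, 1 < x → x < 1000330384 → isP x = true → x.Prime

theorem detects_rough : Detects rough := fun _ => prime_of_rough

theorem detects_primeTest : Detects primeTest := fun _ => prime_of_primeTest

theorem exists_of_primeBelow {isP : ℕ → Bool} {n T fuel x : ℕ}
    (h : primeBelow isP n T fuel x = true) :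
    ∃ y, isP y = true ∧ n ≤ y + T ∧ y + 3 ≤ n ∧ n < 2 * y := by
  induction fuel generalizing x with
  | zero => exact absurd h Bool.false_ne_true
  | succ fuel ih =>
    have h1 : primeBelow isP n T (fuel + 1) x =
      (Bool.rec (primeBelow isP n T fuel (x - 2)) (isNear n T x) (isP x) : Bool) := rfl
    rw [h1] at h
    cases hb : isP x with
    | false => rw [hb] at h; exact ih h
    | true =>
      rw [hb] at h
      obtain ⟨h2, h3⟩ := both_iff.mp h
      obtain ⟨h3, h4⟩ := both_iff.mp h3
      exact ⟨x, hb, Nat.le_of_ble_eq_true h2, Nat.le_of_ble_eq_true h3, Nat.le_of_ble_eq_true h4⟩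

theorem universallyGenerated_of_slowAt {isP : ℕ → Bool} (hP : Detects isP) {n : ℕ}
    (hn : n < 1000330384) {e : ℕ × ℕ} (h : slowAt isP n e = true) : UniversallyGenerated n := by
  obtain ⟨h1, h2⟩ := both_iff.mp h
  obtain ⟨y, hy, hy1, hy2, hy3⟩ := exists_of_primeBelow h2
  obtain ⟨p, a, hp, hpn, hpa⟩ := exists_prime_pow_dvd_of_mod h1
  refine universallyGenerated_of_sub (δ := n - y) hp hpn (by omega) (by omega) (by omega) ?_
  rw [show n - (n - y) = y by omega]
  exact hP y (by omega) (by omega) hy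

theorem dvd_choose_of_lucas {p n k : ℕ} (hp : p.Prime) (h : lucas p n k = true) :
    p ∣ n.choose k := by
  unfold lucas at h
  generalize 30 = fuel at h
  induction fuel generalizing n k with
  | zero => exact absurd h Bool.false_ne_true
  | succ fuel ih =>
    rcases either_iff.mp h with h | h
    · exact dvd_choose_of_mod_lt hp (Nat.le_of_ble_eq_true h)
    · have := Fact.mk hp
      have h1 := Choose.choose_modEq_choose_mod_mul_choose_div_nat (n := n) (k := k) (p := p)
      have h2 : p ∣ (n % p).choose (k % p) * (n / p).choose (k / p) := (ih h).mul_left _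
      exact (h1.dvd_iff dvd_rfl).mpr h2

theorem mod_eq_of_dvd_add {q x t : ℕ} (ht : t < q) (h : q ∣ x + t) : (q - x % q) % q = t := by
  have hq : 0 < q := by omega
  have hx := Nat.mod_lt x hq
  have h1 : q ∣ x % q + t := by
    rw [Nat.dvd_iff_mod_eq_zero] at h ⊢
    rwa [Nat.mod_add_mod]
  obtain ⟨k, hk⟩ := h1
  have hk2 : k < 2 := by
    by_contra hk2
    have : q * 2 ≤ q * k := Nat.mul_le_mul_left _ (by omega)
    omega
  interval_cases k
  · rw [show x % q = 0 by omega, Nat.sub_zero, Nat.mod_self]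
    omega
  · rw [show q - x % q = t by omega, Nat.mod_eq_of_lt ht]

theorem universallyGenerated_of_witnessTest {n c s ℓ p q a : ℕ} (hp : p.Prime) (hℓ : ℓ.Prime)
    (hqp : q ∣ p ^ a) (hqn : q ∣ n) (h : witness n c s ℓ p q = true) : UniversallyGenerated n := by
  obtain ⟨h1, h⟩ := both_iff.mp h
  obtain ⟨hT, h⟩ := both_iff.mp h
  obtain ⟨hB, h⟩ := both_iff.mp h
  obtain ⟨h2, h⟩ := both_iff.mp h
  obtain ⟨h2, h3⟩ := both_iff.mp h2
  obtain ⟨h3, h4⟩ := both_iff.mp h3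
  obtain ⟨h5, h⟩ := both_iff.mp h
  obtain ⟨h6, h7⟩ := both_iff.mp h
  have h1 : s < q := Nat.le_of_ble_eq_true h1
  have h2 : n = c * ℓ + s := Nat.eq_of_beq_eq_true h2
  have h3 : 1 ≤ c := Nat.le_of_ble_eq_true h3
  have h4 : c < ℓ := Nat.le_of_ble_eq_true h4
  have h5 : s < ℓ := Nat.le_of_ble_eq_true h5
  have h6 : 3 ≤ ℓ := Nat.le_of_ble_eq_true h6
  have h7 : ℓ + 3 ≤ n := Nat.le_of_ble_eq_true h7
  rw [upTo_iff] at hT hB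
  refine universallyGenerated_of_witness (by omega) hp hℓ hqp hqn h2 h4 h5 h1 h6 h3 ?_ ?_
    ⟨ℓ, Or.inr rfl, h6, by omega, Or.inr h7⟩
  · intro i t hi1 hic hts hdvd
    have h8 := hT i hi1 hic
    unfold target at h8
    simp only [force_eq, mod_raw, sub_raw, mul_raw, add_raw] at h8
    rw [mod_eq_of_dvd_add (by omega) hdvd, either_iff, either_iff] at h8
    rcases h8 with h8 | h8 | h8
    · have := Nat.le_of_ble_eq_true h8
      omega
    · exact Or.inl (Nat.eq_of_beq_eq_true h8)
    · exact Or.inr (dvd_choose_of_lucas hp h8)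
  · intro k hk2 hkc hkn hpk
    have h8 := hB k (by omega) hkc
    unfold blockOK at h8
    rw [either_iff, either_iff, mod_raw, mod_raw, mod_raw, div_raw,
      Nat.mod_eq_zero_of_dvd hkn, Nat.mod_eq_zero_of_dvd hpk] at h8
    rcases h8 with (h8 | h8) | h8
    · exact absurd (Nat.le_of_ble_eq_true h8) (by omega)
    · exact absurd (Nat.le_of_ble_eq_true h8) (by omega)
    · exact Nat.le_of_ble_eq_true h8

theorem mem_of_mem_primesOf {ps : List ℕ} {n p : ℕ} (h : p ∈ primesOf ps n) : p ∈ ps := by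
  induction ps with
  | nil => exact h
  | cons a ps ih =>
    have h1 : primesOf (a :: ps) n =
      (Bool.rec (primesOf ps n) (a :: primesOf ps n) (Nat.beq (n % a) 0) : List ℕ) := rfl
    rw [h1] at h
    cases hb : Nat.beq (n % a) 0 with
    | false => rw [hb] at h; exact List.mem_cons_of_mem _ (ih h)
    | true =>
      rw [hb] at h
      rcases List.mem_cons.mp h with rfl | h
      · exact List.mem_cons_self
      · exact List.mem_cons_of_mem _ (ih h)

theorem universallyGenerated_of_hardAt {isP : ℕ → Bool} (hP : Detects isP) {ps : List ℕ}
    (hps : ∀ p ∈ ps, p.Prime) {n c fuel ℓ : ℕ} (hn : n < 1000330384)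
    (h : hardAt isP ps n c fuel ℓ = true) : UniversallyGenerated n := by
  induction fuel generalizing ℓ with
  | zero => exact absurd h Bool.false_ne_true
  | succ fuel ih =>
    have h1 : hardAt isP ps n c (fuel + 1) ℓ = (Bool.rec (hardAt isP ps n c fuel (ℓ - 1))
      (tryPrime ps n c (hardAt isP ps n c fuel) ℓ) (isP ℓ) : Bool) := rfl
    rw [h1] at h
    cases hb : isP ℓ with
    | false => rw [hb] at h; exact ih h
    | true =>
      rw [hb] at h
      rcases either_iff.mp h with h | h
      · obtain ⟨p, hp, hw⟩ := anyOf_iff.mp h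
        have hpp := hps p (mem_of_mem_primesOf hp)
        obtain ⟨-, h2⟩ := both_iff.mp (both_iff.mp (both_iff.mp (both_iff.mp hw).2).2).2
        obtain ⟨h3, h4⟩ := both_iff.mp (both_iff.mp h2).2
        have h3 : 3 ≤ ℓ := Nat.le_of_ble_eq_true h3
        have h4 : ℓ + 3 ≤ n := Nat.le_of_ble_eq_true h4
        exact universallyGenerated_of_witnessTest hpp (hP ℓ (by omega) (by omega) hb)
          (Nat.gcd_dvd_left _ _) (Nat.gcd_dvd_right _ _) hw
      · exact ih h

theorem universallyGenerated_of_hardWith {isP : ℕ → Bool} (hP : Detects isP) {ps : List ℕ}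
    (hps : ∀ p ∈ ps, p.Prime) {S c₀ n : ℕ} (hn : n < 1000330384)
    (h : hardWith isP ps S c₀ n = true) : UniversallyGenerated n := by
  unfold hardWith at h
  generalize 29 = fuel at h
  induction fuel with
  | zero => exact absurd h Bool.false_ne_true
  | succ fuel ih =>
    rcases either_iff.mp h with h | h
    · exact ih h
    · exact universallyGenerated_of_hardAt hP hps hn h

theorem prime_of_mem_firstPrimes : ∀ p ∈ firstPrimes, p.Prime := by
  simp only [firstPrimes, List.forall_mem_cons]
  norm_num

theorem prime_of_mem_tablePrimes : ∀ p ∈ tablePrimes, p.Prime := by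
  intro p hp
  unfold tablePrimes at hp
  rcases List.mem_append.mp hp with h | h
  · exact prime_of_mem_firstPrimes p h
  · clear hp
    revert p
    simp only [List.forall_mem_cons]
    norm_num

theorem universallyGenerated_of_hardFull {n : ℕ} (hn : n < 1000330384)
    (h : hardFull n = true) : UniversallyGenerated n :=
  universallyGenerated_of_hardWith detects_primeTest prime_of_mem_tablePrimes hn h

theorem universallyGenerated_of_slow {n : ℕ} (hn : n < 1000330384) (h : slow n = true) :
    UniversallyGenerated n := by
  rcases either_iff.mp h with h | h
  · obtain ⟨e, -, he⟩ := anyOf_iff.mp h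
    exact universallyGenerated_of_slowAt detects_rough hn he
  · rcases either_iff.mp h with h | h
    · exact universallyGenerated_of_hardWith detects_rough prime_of_mem_tablePrimes hn h
    · exact universallyGenerated_of_hardFull hn h

theorem universallyGenerated_of_smallOK {n : ℕ} (hn : n < 1000330384) (h : smallOK n = true) :
    UniversallyGenerated n := by
  rcases either_iff.mp h with h | h
  · obtain ⟨e, -, he⟩ := anyOf_iff.mp h
    exact universallyGenerated_of_slowAt detects_primeTest hn he
  · exact universallyGenerated_of_hardFull hn h

/-- A clear bit is settled by the sieve. A set bit is reached by `bitsTree`, and is settled by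
`slow` or by a prime power divisor greater than 360. -/
theorem universallyGenerated_of_windowOK {L i n p a : ℕ} (hL : L < 2 ^ 31)
    (hiL : 30 * (i + L) ≤ 1000330384) (hi : 100 ≤ i) (h : windowOK L i = true)
    (hn1 : 30 * (i + 11) ≤ n) (hn2 : n < 30 * (i + L)) (hp : p.Prime) (hpn : p ^ a ∣ n)
    (hpa : 79 ≤ p ^ a) : UniversallyGenerated n := by
  obtain ⟨hgap, hres⟩ := both_iff.mp h
  obtain ⟨t, ht⟩ := Nat.exists_eq_add_of_le (show i + 11 ≤ n / 30 by omega)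
  have hn : n = 30 * (i + (t + 11)) + n % 30 := by omega
  have hρ : n % 30 < 30 := Nat.mod_lt _ (by norm_num)
  generalize n % 30 = ρ at hn hρ
  have htL : t + 11 < L := by omega
  have hmem : ρ ∈ residues := by
    unfold residues
    interval_cases ρ <;> simp
  have hρ' := allOf_iff.mp hres ρ hmem
  cases hb : (exceptions L i ρ).testBit t with
  | false =>
    exact universallyGenerated_of_testBit_exceptions_eq_false hL hiL hi htL hρ hn hp hpn hpa hb
  | true =>
    obtain ⟨v, k, hvk, h1⟩ := exists_of_bitsTree hρ' hb
    unfold popAt at h1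
    have h2 : popIndex i ρ v k = n := by
      change ρ + 30 * (i + (k + (11 + 2048 * v))) = n
      omega
    rw [h2] at h1
    rcases rec_true_iff.mp h1 with h1 | h1
    -- With `n` in block `t + 11` and the prime in one of the blocks `t, …, t + 9`, the distance is
    -- between 31 and 359.
    · obtain ⟨k, hk, b, hb, hprime⟩ := exists_prime_of_noGap (j := t + 9) hL hiL (by omega)
        (by omega) (by omega) hgap
      obtain ⟨p, a, hp, hpn, hpa⟩ := exists_prime_pow_dvd_of_mod h1
      refine universallyGenerated_of_sub (δ := n - (30 * (i + (t + 9 - k)) + b)) hp hpn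
        (by omega) (by omega) (by omega) ?_
      rwa [show n - (n - (30 * (i + (t + 9 - k)) + b)) = 30 * (i + (t + 9 - k)) + b by omega]
    · exact universallyGenerated_of_slow (by omega) h1

end Individual

/-! ### Numbers all of whose prime power divisors are below 79 -/

section Enumeration

theorem exists_prime_of_nearPrime {n q : ℕ} {l : List ℕ} (h : nearPrime n q l = true) :
    ∃ d ∈ l, d < q ∧ rough (n - d) = true := by
  induction l with
  | nil => exact absurd h Bool.false_ne_true
  | cons d l ih =>
    have h1 : nearPrime n q (d :: l) = (Bool.rec (nearPrime n q l)
      (Bool.rec true (nearPrime n q l) (Nat.ble q d)) (rough (n - d)) : Bool) := rfl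
    rw [h1] at h
    have ih' : nearPrime n q l = true → ∃ d' ∈ d :: l, d' < q ∧ rough (n - d') = true :=
      fun h => by
        obtain ⟨d', h1, h2⟩ := ih h
        exact ⟨d', List.mem_cons_of_mem _ h1, h2⟩
    cases hb : rough (n - d) with
    | false => rw [hb] at h; exact ih' h
    | true =>
      rw [hb] at h
      cases hq : Nat.ble q d with
      | false =>
        refine ⟨d, List.mem_cons_self, ?_, hb⟩
        by_contra hlt
        rw [Nat.ble_eq_true_of_le (by omega)] at hq
        exact Bool.false_ne_true hq.symm
      | true => rw [hq] at h; exact ih' h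

theorem distances_bounds (r : ℕ) : ∀ d ∈ distances r, 3 ≤ d ∧ d ≤ 72 := by
  unfold distances
  cases Nat.ble r 2 <;> cases Nat.beq r 1 <;> cases Nat.beq r 0 <;> cases Nat.beq r 4 <;>
    cases Nat.beq r 3 <;> decide

theorem universallyGenerated_of_leafOK {n q p a : ℕ} (hn1 : 4096 ≤ n) (hn : n < 1000330384)
    (hp : p.Prime) (hq : q = p ^ a) (hqn : q ∣ n) (h : leafOK n q = true) :
    UniversallyGenerated n := by
  rcases rec_true_iff.mp h with h | h
  · obtain ⟨d, hd, hdq, hrough⟩ := exists_prime_of_nearPrime h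
    obtain ⟨hd3, hd72⟩ := distances_bounds _ d hd
    exact universallyGenerated_of_sub hp (hq ▸ hqn) hd3 (hq ▸ hdq) (by omega)
      (prime_of_rough (by omega) (by omega) hrough)
  · rcases rec_true_iff.mp h with h | h
    · have := Nat.le_of_ble_eq_true h
      omega
    · change (Bool.rec (either (hardWith primeTest firstPrimes 72 2 n) (hardFull n)) (smallOK n)
        (Nat.ble n 31999) : Bool) = true at h
      cases hb : Nat.ble n 31999 with
      | true => rw [hb] at h; exact universallyGenerated_of_smallOK hn h
      | false =>
        rw [hb] at h
        rcases either_iff.mp h with h | h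
        · exact universallyGenerated_of_hardWith detects_primeTest prime_of_mem_firstPrimes hn h
        · exact universallyGenerated_of_hardFull hn h

def enumRow (ih : ℕ → ℕ → Bool) (m q : ℕ) (r : List ℕ) : Bool :=
  List.rec true (fun e _ next => Bool.rec true
    (Bool.rec false next (ih (Nat.mul m e) (maxNat q e))) (Nat.ble (Nat.mul m e) 1000000000)) r

theorem enum_cons_iff {r : List ℕ} {rows : List (List ℕ)} {m q : ℕ} :
    enum (r :: rows) m q = true ↔ enum rows m q = true ∧ enumRow (enum rows) m q r = true :=
  rec_false_iff

/-- The loop stops at the first entry exceeding the bound; as the row increases, no admissible entry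
is lost. -/
theorem apply_of_enumRow {ih : ℕ → ℕ → Bool} {m q e : ℕ} {r : List ℕ}
    (hr : r.Pairwise (· ≤ ·)) (h : enumRow ih m q r = true) (he : e ∈ r)
    (hme : m * e ≤ 1000000000) : ih (m * e) (maxNat q e) = true := by
  induction r with
  | nil => simp at he
  | cons b r hi =>
    have h1 : enumRow ih m q (b :: r) = (Bool.rec true
      (Bool.rec false (enumRow ih m q r) (ih (m * b) (maxNat q b)))
      (Nat.ble (m * b) 1000000000) : Bool) := rfl
    rw [h1] at h
    rw [List.pairwise_cons] at hr
    rcases List.mem_cons.mp he with rfl | he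
    · rw [Nat.ble_eq_true_of_le hme] at h
      exact (rec_false_iff.mp h).1
    · rw [Nat.ble_eq_true_of_le ((Nat.mul_le_mul_left m (hr.1 e he)).trans hme)] at h
      exact hi hr.2 (rec_false_iff.mp h).2 he

/-- The rows are increasing lists of powers of their first elements, which are different primes. -/
def PowerRows (rows : List (List ℕ)) : Prop :=
  rows.Pairwise (fun r s => r.headD 0 ≠ s.headD 0) ∧
    ∀ r ∈ rows, (r.headD 0).Prime ∧ r.Pairwise (· ≤ ·) ∧ ∀ e ∈ r, e ∣ r.headD 0 ^ 30

/-- The exact power of the row's prime is split off from `k`: it is either 1 or an entry of this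
row, and the cofactor is built from the remaining rows. -/
theorem exists_leafOK_of_enum {rows : List (List ℕ)} (hrows : PowerRows rows) {m q k : ℕ}
    (hk : k ≠ 0) (hmk : m * k ≤ 1000000000)
    (hpk : ∀ p a, p.Prime → a ≠ 0 → p ^ a ∣ k → ∃ r ∈ rows, p ^ a ∈ r)
    (h : enum rows m q = true) :
    ∃ Q, leafOK (m * k) Q = true ∧ (Q = q ∨ ∃ p a, p.Prime ∧ Q = p ^ a ∧ Q ∣ k) := by
  induction rows generalizing m q k with
  | nil =>
    have hk1 : k = 1 := by
      by_contra hk1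
      obtain ⟨p, hp, hpk'⟩ := Nat.exists_prime_and_dvd hk1
      obtain ⟨r, hr, -⟩ := hpk p 1 hp one_ne_zero (by rwa [pow_one])
      simp at hr
    subst hk1
    exact ⟨q, by rw [mul_one]; exact h, Or.inl rfl⟩
  | cons r rows ih =>
    obtain ⟨hp, hsort, hpow⟩ := hrows.2 r List.mem_cons_self
    obtain ⟨hne, hrows1⟩ := List.pairwise_cons.mp hrows.1
    have hrows' : PowerRows rows :=
      ⟨hrows1, fun s hs => hrows.2 s (List.mem_cons_of_mem _ hs)⟩
    obtain ⟨h1, h2⟩ := enum_cons_iff.mp h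
    obtain ⟨b, k', hk', rfl⟩ := Nat.exists_eq_pow_mul_and_not_dvd hk (r.headD 0) hp.ne_one
    generalize r.headD 0 = p at *
    have hk'0 : k' ≠ 0 := by rintro rfl; simp at hk
    have hpk' : ∀ p' a, p'.Prime → a ≠ 0 → p' ^ a ∣ k' → ∃ r ∈ rows, p' ^ a ∈ r := by
      intro p' a hp' ha hd
      obtain ⟨s, hs, hps⟩ := hpk p' a hp' ha (hd.mul_left _)
      rcases List.mem_cons.mp hs with rfl | hs
      · have h3 : p' ∣ p := hp'.dvd_of_dvd_pow ((dvd_pow_self p' ha).trans (hpow _ hps))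
        rw [(Nat.prime_dvd_prime_iff_eq hp' hp).mp h3] at hd
        exact absurd ((dvd_pow_self p ha).trans hd) hk'
      · exact ⟨s, hs, hps⟩
    rcases Nat.eq_zero_or_pos b with rfl | hb
    · rw [pow_zero, one_mul] at hmk ⊢
      exact ih hrows' hk'0 hmk hpk' h1
    · have hmem : p ^ b ∈ r := by
        obtain ⟨s, hs, hps⟩ := hpk p b hp hb.ne' (dvd_mul_right _ _)
        rcases List.mem_cons.mp hs with rfl | hs
        · exact hps
        · obtain ⟨hs1, -, hs2⟩ := hrows'.2 s hs
          have h3 := hp.dvd_of_dvd_pow ((dvd_pow_self p hb.ne').trans (hs2 _ hps))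
          exact absurd ((Nat.prime_dvd_prime_iff_eq hp hs1).mp h3) (hne s hs)
      rw [← mul_assoc] at hmk ⊢
      have h3 := apply_of_enumRow hsort h2 hmem
        ((Nat.le_mul_of_pos_right _ (Nat.pos_of_ne_zero hk'0)).trans hmk)
      obtain ⟨Q, hQ, hQ'⟩ := ih hrows' hk'0 hmk hpk' h3
      refine ⟨Q, hQ, ?_⟩
      rcases hQ' with hQ' | ⟨p', a, hp', rfl, hd⟩
      · unfold maxNat at hQ'
        cases hble : Nat.ble q (p ^ b) with
        | false => rw [hble] at hQ'; exact Or.inl hQ'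
        | true => rw [hble] at hQ'; exact Or.inr ⟨p, b, hp, hQ', hQ' ▸ dvd_mul_right _ _⟩
      · exact Or.inr ⟨p', a, hp', rfl, hd.mul_left _⟩

/-- Peels off a row with a single prime, so that the enumeration can be verified in independent
pieces sorted by largest prime. -/
theorem enum_drop {rows : List (List ℕ)} {k e : ℕ}
    (hk : rows.drop k = [e] :: rows.drop (k + 1)) (he : 1 ≤ e)
    (h1 : enum (rows.drop (k + 1)) e e = true) (h2 : enum (rows.drop (k + 1)) 1 1 = true) :
    enum (rows.drop k) 1 1 = true := by
  rw [hk, enum_cons_iff]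
  refine ⟨h2, ?_⟩
  have h3 : enumRow (enum (rows.drop (k + 1))) 1 1 [e] = (Bool.rec true
    (Bool.rec false true (enum (rows.drop (k + 1)) (1 * e) (maxNat 1 e)))
    (Nat.ble (1 * e) 1000000000) : Bool) := rfl
  have h4 : maxNat 1 e = e := by
    unfold maxNat
    rw [Nat.ble_eq_true_of_le he]
  rw [h3, h4, one_mul, h1]
  cases Nat.ble e 1000000000 <;> rfl

theorem powerRows_powerRows : PowerRows powerRows := by
  refine ⟨by unfold powerRows; decide, ?_⟩
  unfold powerRows
  simp only [List.forall_mem_cons, List.headD_cons]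
  norm_num

theorem exists_mem_powerRows {p a : ℕ} (hp : p.Prime) (ha : a ≠ 0) (h : p ^ a < 79) :
    ∃ r ∈ powerRows, p ^ a ∈ r := by
  have key : ∀ q < 79, 1 < q → (∃ b < 18, b ∣ q ∧ 1 < b ∧ 1 < q / b ∧ Nat.gcd b (q / b) = 1) ∨
      ∃ r ∈ powerRows, q ∈ r := by decide +kernel
  rcases key _ h (Nat.one_lt_pow ha hp.one_lt) with ⟨b, -, hb, hb1, hc1, hbc⟩ | h
  · exact absurd hbc (not_coprime_split hp (Nat.mul_div_cancel' hb) hb1 hc1)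
  · exact h

theorem universallyGenerated_of_enum {n : ℕ} (hn1 : 4096 ≤ n) (hn : n ≤ 1000000000)
    (hsmooth : ∀ p a, p.Prime → p ^ a ∣ n → p ^ a < 79) (h : enum powerRows 1 1 = true) :
    UniversallyGenerated n := by
  obtain ⟨Q, hQ, hQ'⟩ := exists_leafOK_of_enum powerRows_powerRows (m := 1) (k := n) (by omega)
    (by omega) (fun p a hp ha hd => exists_mem_powerRows hp ha (hsmooth p a hp hd)) h
  rw [one_mul] at hQ
  rcases hQ' with rfl | ⟨p, a, hp, rfl, hd⟩
  -- The initial value `Q = 1` counts as `2 ^ 0`.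
  · exact universallyGenerated_of_leafOK hn1 (by omega) Nat.prime_two (pow_zero 2).symm
      (one_dvd _) hQ
  · exact universallyGenerated_of_leafOK hn1 (by omega) hp rfl hd hQ

end Enumeration

/-! ### The computations -/

section Checks

theorem small_checks :
    allDyadic (fun n => either (Nat.ble n 6) (smallOK n)) 13 0 = true := by decide +kernel

-- Consecutive windows overlap in `666711 - 666700 = 11` blocks, exactly those dropped at the start
-- of each, so the tested ranges abut. They begin at `30 * (160 + 11) = 5130` and end beyond `10 ^
-- 9`.
set_option maxHeartbeats 0 in
theorem window_and_enum_checks :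
    (∀ w < 50, force (windowOK 666711) (Nat.add 160 (Nat.mul 666700 w)) = true) ∧
      enum (powerRows.drop 1) 73 73 = true ∧ enum (powerRows.drop 2) 71 71 = true ∧
      enum (powerRows.drop 3) 67 67 = true ∧ enum (powerRows.drop 4) 61 61 = true ∧
      enum (powerRows.drop 5) 59 59 = true ∧ enum (powerRows.drop 6) 53 53 = true ∧
      enum (powerRows.drop 7) 47 47 = true ∧ enum (powerRows.drop 8) 43 43 = true ∧
      enum (powerRows.drop 8) 1 1 = true := by
  refine ⟨fun w hw => ?_, by decide +kernel, by decide +kernel, by decide +kernel,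
    by decide +kernel, by decide +kernel, by decide +kernel, by decide +kernel,
    by decide +kernel, by decide +kernel⟩
  interval_cases w <;> decide +kernel

theorem enum_powerRows : enum powerRows 1 1 = true := by
  obtain ⟨-, h0, h1, h2, h3, h4, h5, h6, h7, h⟩ := window_and_enum_checks
  exact enum_drop (k := 0) rfl (by norm_num) h0 <| enum_drop rfl (by norm_num) h1 <|
    enum_drop rfl (by norm_num) h2 <| enum_drop rfl (by norm_num) h3 <|
    enum_drop rfl (by norm_num) h4 <| enum_drop rfl (by norm_num) h5 <|
    enum_drop rfl (by norm_num) h6 <| enum_drop rfl (by norm_num) h7 h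

end Checks

theorem universallyGenerated_of_lt {n : ℕ} (hn6 : 6 < n) (hn : n < 8192) :
    UniversallyGenerated n := by
  rcases either_iff.mp (apply_of_allDyadic small_checks (x := n) (by norm_num)
    (by norm_num; exact hn)) with h | h
  · exact absurd (Nat.le_of_ble_eq_true h) (by omega)
  · exact universallyGenerated_of_smallOK (by omega) h

theorem universallyGenerated_of_prime_pow_dvd {n p a : ℕ} (hn1 : 8192 ≤ n) (hn : n ≤ 1000000000)
    (hp : p.Prime) (hpn : p ^ a ∣ n) (hpa : 79 ≤ p ^ a) : UniversallyGenerated n := by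
  -- `171 = 160 + 11` is the first block tested in the first window.
  obtain ⟨w, hw⟩ : ∃ w, w = (n / 30 - 171) / 666700 := ⟨_, rfl⟩
  have hw1 : w < 50 := by omega
  have h := window_and_enum_checks.1 w hw1
  rw [force_eq, add_raw, mul_raw] at h
  have hiL : 30 * (160 + 666700 * w + 666711) ≤ 1000330384 := by
    linarith
  exact universallyGenerated_of_windowOK (by norm_num) hiL (by omega) h (by omega) (by omega)
    hp hpn hpa

end KernelSearch

theorem proposition1p9 (n : ℕ) (hpos : 1 ≤ n) (hn : n ≤ 1000000000) :
    UniversallyGenerated n := by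
  rcases Nat.lt_or_ge n 7 with h | h
  · interval_cases n
    · exact universallyGenerated_of_le_two (by norm_num)
    · exact universallyGenerated_of_le_two (by norm_num)
    · exact universallyGenerated_three
    · exact universallyGenerated_four
    · exact universallyGenerated_five
    · exact universallyGenerated_six
  rcases Nat.lt_or_ge n 8192 with h1 | h1
  · exact KernelSearch.universallyGenerated_of_lt h h1
  -- The prime power following 73 is 79: below it the enumeration is complete, from it on the sieve
  -- table applies.
  by_cases hs : ∀ p a, p.Prime → p ^ a ∣ n → p ^ a < 79
  · exact KernelSearch.universallyGenerated_of_enum (by omega) hn hs KernelSearch.enum_powerRows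
  · push Not at hs
    obtain ⟨p, a, hp, hpn, hpa⟩ := hs
    exact KernelSearch.universallyGenerated_of_prime_pow_dvd h1 hn hp hpn hpa
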